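/- **Setting.** Fix integers $d,D\ge 0$. All graphs are simple, not necessarily connected, and have vertex degrees at most $d$. $d_G$ is the shortest path distance, infinite between different components, and $B_s(G,x)$ is the ball of radius $s$ around $x$. The graph $G$ is *$D$-doubling* if $|B_{2s}(G,x)|\le D\,|B_s(G,x)|$ for all $x\in V(G)$ and all integers $s\ge 1$. $I(G)$ is the size of a largest independent set of $G$. For a finite set $Q$ and an integer $k\ge 1$, let $U^{k,Q}_d$ be the set of rooted-labeled isomorphism classes of rooted $Q$-labeled balls of radius at most $k$ with vertex degree bound $d$, that is, of graphs with vertex degrees at most $d$, a vertex labeling by $Q$ and a root from which every vertex has distance at most $k$. For $\phi:V(G)\to Q$ let $B_k(G,x,\phi)\in U^{k,Q}_d$ be the class of the $k$-ball of $G$ around $x$ with root $x$ and the labels $\phi$. Put $CU^k_d=U^{k,\{0,1\}^k}_d$. For $\lambda:V(G)\to\{0,1\}^{\mathbb N}$ let $(\lambda)_k:V(G)\to\{0,1\}^k$ be the projection of $\lambda$ to the first $k$ coordinates. Let $\mathcal G$ be a family of graphs (repetitions allowed). Labelings $\{\lambda_G:V(G)\to\{0,1\}^{\mathbb N}\}_{G\in\mathcal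 G}$ form a *proper labeling* if for every $r\ge 1$ there is $s\ge1$ such that $B_s(G,x,(\lambda_G)_s)\ne B_s(G,y,(\lambda_G)_s)$ whenever $G\in\mathcal G$, $x,y\in V(G)$ and $0<d_G(x,y)\le r$. A function $\Theta:CU^m_d\to\{0,1\}$ (an oracle) computes the labelings $\lambda_G^\Theta(x)=\Theta(B_m(G,x,(\lambda_G)_m))$. A function $\Omega:U^{l,\{0,1\}}_d\to\{Y,N\}$ *accepts* $\phi:V(G)\to\{0,1\}$ if $\Omega(B_l(G,x,\phi))=Y$ for all $x\in V(G)$. It is a *local verifier for the $\varepsilon$-approximating maximum independent set problem* in a class $\mathcal H$ of finite graphs if, for every $G\in\mathcal H$ and every $\phi:V(G)\to\{0,1\}$ that $\Omega$ accepts, $\phi^{-1}(0)$ is an independent set of $G$ and $|\phi^{-1}(0)|\ge(1-\varepsilon)I(G)$. **Theorem.** Let $\mathcal G$ be a family of finite $D$-doubling graphs with vertex degrees at most $d$, equipped with a proper labeling $\{\lambda_G\}_{G\in\mathcal G}$. Then for every $\varepsilon>0$ there exist integers $m,l\ge1$ and functions $\Theta_\varepsilon:CU^m_d\to\{0,1\}$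 and $\Omega_\varepsilon:U^{l,\{0,1\}}_d\to\{Y,N\}$ such that 1. $\Omega_\varepsilon$ is a local verifier for the $\varepsilon$-approximating maximum independent set problem in the class of all finite $D$-doubling graphs with vertex degrees at most $d$; 2. for every $G\in\mathcal G$, the set $(\lambda_G^{\Theta_\varepsilon})^{-1}(0)$ is an independent set of $G$; 3. for every $G\in\mathcal G$, $|(\lambda_G^{\Theta_\varepsilon})^{-1}(0)|\ge(1-\varepsilon)I(G)$; 4. for every $G\in\mathcal G$, $\Omega_\varepsilon$ accepts $\lambda_G^{\Theta_\varepsilon}$. -/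

import Mathlib

universe u v

namespace LocalMIS

/-- The ball of radius `s` around `x`: all vertices at graph distance at most `s` from `x`. Vertices
in other components are at distance `⊤`. -/
def closedBall {V : Type u} (G : SimpleGraph V) (x : V) (s : ℕ) : Set V :=
  {y | G.edist x y ≤ s}

/-- `G` has vertex degree bound `d`. -/
def DegreeBound {V : Type u} (G : SimpleGraph V) (d : ℕ) : Prop :=
  ∀ x, (G.neighborSet x).encard ≤ d

/-- `G` is `D`-doubling: `|B_{2s}(G, x)| ≤ D |B_s(G, x)|` for all vertices `x` and all `s ≥ 1`. -/
def IsDoubling {V : Type u} (G : SimpleGraph V) (D : ℕ) : Prop :=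
  ∀ (x : V) (s : ℕ), 1 ≤ s → (closedBall G x (2 * s)).encard ≤ D * (closedBall G x s).encard

/-- Rooted `Q`-labeled balls of radius at most `k` with vertex degree bound `d`. Such a graph is
automatically connected and finite. -/
structure RootedBall (d k : ℕ) (Q : Type) : Type (u + 1) where
  V : Type u
  graph : SimpleGraph V
  root : V
  label : V → Q
  degreeBound : DegreeBound graph d
  edist_root_le : ∀ y, graph.edist root y ≤ k

/-- Rooted-labeled isomorphism: a graph isomorphism that preserves the root and all labels. -/
def RootedBall.Iso {d k : ℕ} {Q : Type} (A B : RootedBall.{u} d k Q) : Prop :=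
  ∃ e : A.graph ≃g B.graph, e A.root = B.root ∧ ∀ y, B.label (e y) = A.label y

theorem RootedBall.iso_equivalence (d k : ℕ) (Q : Type) :
    Equivalence (RootedBall.Iso : RootedBall.{u} d k Q → RootedBall.{u} d k Q → Prop) where
  refl A := ⟨SimpleGraph.Iso.refl, rfl, fun _ => rfl⟩
  symm := by
    rintro A B ⟨e, hr, hl⟩
    refine ⟨e.symm, by rw [← hr]; exact e.symm_apply_apply _, fun y => ?_⟩
    rw [← hl]
    exact congrArg B.label (e.apply_symm_apply y)
  trans := by
    rintro A B C ⟨e, hr, hl⟩ ⟨f, hr', hl'⟩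
    refine ⟨f.comp e, ?_, fun y => ?_⟩
    · change f (e A.root) = C.root
      rw [hr, hr']
    · change C.label (f (e y)) = A.label y
      rw [hl', hl]

instance RootedBall.setoid (d k : ℕ) (Q : Type) : Setoid (RootedBall.{u} d k Q) :=
  ⟨RootedBall.Iso, RootedBall.iso_equivalence d k Q⟩

/-- The set `U^{k,Q}_d` of rooted-labeled isomorphism classes of rooted `Q`-labeled balls of radius
at most `k` with vertex degree bound `d`. -/
def BallClass (d k : ℕ) (Q : Type) : Type (u + 1) :=
  Quotient (RootedBall.setoid.{u} d k Q)

/-- The set `CU^k_d`: balls of radius at most `k` with labels in `{0,1}^[k]`. -/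
abbrev CantorBallClass (d k : ℕ) : Type (u + 1) :=
  BallClass.{u} d k (Fin k → Fin 2)

theorem closedBall_degreeBound {V : Type u} {G : SimpleGraph V} {d : ℕ} (hG : DegreeBound G d)
    (x : V) (k : ℕ) : DegreeBound (G.induce (closedBall G x k)) d := by
  intro y
  refine le_trans ?_ (hG y.1)
  refine Set.encard_le_encard_of_injOn (f := Subtype.val) ?_ Subtype.val_injective.injOn
  intro z hz
  exact hz

theorem closedBall_edist_le {V : Type u} (G : SimpleGraph V) (x : V) (k : ℕ)
    (hx : x ∈ closedBall G x k) (y : closedBall G x k) :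
    (G.induce (closedBall G x k)).edist ⟨x, hx⟩ y ≤ k := by
  classical
  obtain ⟨y, hy⟩ := y
  have hy' : G.edist x y ≤ k := hy
  obtain ⟨p, hp⟩ := G.exists_walk_of_edist_ne_top (ne_top_of_le_ne_top (ENat.natCast_ne_top k) hy')
  have hs : ∀ z ∈ p.support, z ∈ closedBall G x k := by
    intro z hz
    have h1 : G.edist x z ≤ (p.takeUntil z hz).length := G.edist_le _
    have h2 : ((p.takeUntil z hz).length : ℕ∞) ≤ p.length := by
      exact_mod_cast p.length_takeUntil_le_length hz
    exact h1.trans (h2.trans (hp.le.trans hy'))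
  have h3 : (G.induce (closedBall G x k)).edist ⟨x, hx⟩ ⟨y, hy⟩ ≤ (p.induce _ hs).length :=
    SimpleGraph.edist_le _
  have h4 : (p.induce _ hs).length = p.length := by
    rw [← SimpleGraph.Walk.length_map (SimpleGraph.Embedding.induce _).toHom (p.induce _ hs),
      SimpleGraph.Walk.map_induce]
    rfl
  rw [h4, hp] at h3
  exact h3.trans hy'

theorem self_mem_closedBall {V : Type u} (G : SimpleGraph V) (x : V) (k : ℕ) :
    x ∈ closedBall G x k := by
  simp [closedBall]

/-- The rooted labeled ball `B_k(G, x, φ)`: the subgraph of `G` induced on the ball of radius `k`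
around `x`, with root `x` and the restriction of the labeling `φ`. -/
def ball {V : Type u} {G : SimpleGraph V} {d : ℕ} (hG : DegreeBound G d) {Q : Type} (φ : V → Q)
    (k : ℕ) (x : V) : RootedBall.{u} d k Q where
  V := closedBall G x k
  graph := G.induce (closedBall G x k)
  root := ⟨x, self_mem_closedBall G x k⟩
  label y := φ y
  degreeBound := closedBall_degreeBound hG x k
  edist_root_le := closedBall_edist_le G x k _

/-- The isomorphism class of `B_k(G, x, φ)` as an element of `U^{k,Q}_d`. -/
def ballClass {V : Type u} {G : SimpleGraph V} {d : ℕ} (hG : DegreeBound G d) {Q : Type}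
    (φ : V → Q) (k : ℕ) (x : V) : BallClass.{u} d k Q :=
  Quotient.mk (RootedBall.setoid d k Q) (ball hG φ k x)

/-- The labeling `(λ)_t` by the first `t` coordinates of a Cantor labeling `λ`. -/
def truncate {V : Type u} (lam : V → ℕ → Fin 2) (t : ℕ) : V → Fin t → Fin 2 :=
  fun x i => lam x i

/-- A family of Cantor labelings of a family of graphs is proper if for every `r ≥ 1` there is
`s ≥ 1` such that any two distinct vertices of one graph of the family at distance at most `r` have
non-isomorphic rooted-labeled balls `B_s(G, x, (λ)_s)` and `B_s(G, y, (λ)_s)`. -/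
def IsProperLabeling {d : ℕ} {ι : Type v} {V : ι → Type u} {G : ∀ i, SimpleGraph (V i)}
    (hG : ∀ i, DegreeBound (G i) d) (lam : ∀ i, V i → ℕ → Fin 2) : Prop :=
  ∀ r : ℕ, 1 ≤ r → ∃ s : ℕ, 1 ≤ s ∧ ∀ (i : ι) (x y : V i),
    0 < (G i).edist x y → (G i).edist x y ≤ r →
      ballClass (hG i) (truncate (lam i) s) s x ≠ ballClass (hG i) (truncate (lam i) s) s y

/-- The labeling `λ^Θ(x) = Θ(B_m(G, x, (λ)_m))` computed by the oracle `Θ : CU^m_d → Q`. -/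
def oracleLabeling {d m : ℕ} {Q : Type} (Θ : CantorBallClass.{u} d m → Q) {V : Type u}
    {G : SimpleGraph V} (hG : DegreeBound G d) (lam : V → ℕ → Fin 2) : V → Q :=
  fun x => Θ (ballClass hG (truncate lam m) m x)

/-- The verifier `Ω : U^{l,Q}_d → {Y, N}` (with `Y = true`) accepts the labeled graph `(G, φ)` if
`Ω(B_l(G, x, φ)) = Y` for all vertices `x`. -/
def Accepts {d l : ℕ} {Q : Type} (Ω : BallClass.{u} d l Q → Bool) {V : Type u}
    {G : SimpleGraph V} (hG : DegreeBound G d) (φ : V → Q) : Prop :=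
  ∀ x, Ω (ballClass hG φ l x) = true

/-- `Ω` is a local verifier for the `ε`-approximating maximum independent set problem in the class
of all finite `D`-doubling graphs of vertex degree bound `d`: it accepts `(G, φ)` only if `φ⁻¹(0)`
is an independent set of size at least `(1 - ε) I(G)`. -/
def IsLocalVerifier {d l : ℕ} (D : ℕ) (ε : ℝ) (Ω : BallClass.{u} d l (Fin 2) → Bool) : Prop :=
  ∀ (V : Type u) [Finite V] (G : SimpleGraph V) (hG : DegreeBound G d), IsDoubling G D →
    ∀ φ : V → Fin 2, Accepts Ω hG φ →
      G.IsIndepSet (φ ⁻¹' {0}) ∧ (1 - ε) * (G.indepNum : ℝ) ≤ ((φ ⁻¹' {0}).ncard : ℝ)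

end LocalMIS

/-! The labeling is produced by a local search. Call an independent set `I`, disjoint from the
current set `S` and contained in a `K`-ball, a profitable exchange if `|I| ≥ (1+η)|S ∩ N(I)|`.
Starting from `∅`, the search runs a fixed number of rounds. Colours read off from the proper
labeling separate vertices at distance at most `2K+1`, so exchanges centred at one colour do not
interfere, and every subset of a `K`-ball is named by its set of colours. A round tries each pair
(colour, set of colours) at least once.

The crux is that the number `M` of rounds need not grow with the graph. For each `x` take the
potential `∑_{y∈S} k(x,y)` with `k(x,y) = q^{d(x,y)} / ∑_z q^{d(y,z)}`. Doubling gives polynomial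
growth, so these potentials are uniformly bounded and the weights have uniformly small tails
(`exists_tail_bound`, `exists_mass_bound`). If `q` is close to `1` in terms of `K`, then `k(x,·)` is
nearly constant on `K`-balls; hence no exchange decreases any potential, and one near `x` raises the
potential of `x` by a definite amount (`sum_add_le_sum_step`). So for each `x` one of `M` rounds is
idle near `x` (`exists_idle_round`). That round depends on `x`, but later rounds never lower the
potential.

At the start of an idle round no profitable exchange exists near `x` (`not_improving_of_idle`). A
layer-cake argument turns this into a comparison of slowly varying sums inside one `K`-ball
(`sum_inter_fball_le`), and averaging over the centres with a second kernel of base `q₁`, fixed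
before `K`, extends it to larger balls (`sum_inter_fball_le_of_tail`). So the final `S` has almost
maximal weight as seen from every `x`.

The verifier checks this almost-maximality with truncated weights. Since the weights of each `y` sum
to `1` over `x`, summing the inequalities gives `|T| ≤ (1+δ)|S| + δ|V|` for every independent `T`,
and `|V| ≤ (d+1) I(G)` absorbs the last term. -/

namespace LocalMIS

/-! ### Polynomial growth of balls and exponential weights -/

section Growth

open scoped Classical

variable {V : Type u} {G : SimpleGraph V}

/-- The weight `q ^ e` of an extended distance `e`, with weight `0` at `⊤`. -/
noncomputable def expWeight (q : ℝ) (e : ℕ∞) : ℝ := if e = ⊤ then 0 else q ^ e.toNat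

theorem expWeight_nonneg {q : ℝ} (hq : 0 ≤ q) (e : ℕ∞) : 0 ≤ expWeight q e := by
  unfold expWeight; split_ifs <;> positivity

theorem expWeight_natCast (q : ℝ) (n : ℕ) : expWeight q n = q ^ n := by
  simp [expWeight]

theorem pow_le_expWeight {q : ℝ} (hq : 0 ≤ q) (hq1 : q ≤ 1) {e : ℕ∞} {n : ℕ} (h : e ≤ n) :
    q ^ n ≤ expWeight q e := by
  obtain ⟨m, rfl⟩ := ENat.ne_top_iff_exists.1 (ne_top_of_le_ne_top (ENat.natCast_ne_top n) h)
  rw [expWeight_natCast]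
  exact pow_le_pow_of_le_one hq hq1 (by exact_mod_cast h)

theorem expWeight_le_one {q : ℝ} (hq : 0 ≤ q) (hq1 : q ≤ 1) (e : ℕ∞) : expWeight q e ≤ 1 := by
  unfold expWeight; split_ifs
  · exact zero_le_one
  · exact pow_le_one₀ hq hq1

theorem mul_expWeight_le {q : ℝ} (hq : 0 ≤ q) (hq1 : q ≤ 1) {e e' : ℕ∞} (h : e' ≤ e + 1) :
    q * expWeight q e ≤ expWeight q e' := by
  by_cases he : e = ⊤
  · simpa [expWeight, he] using expWeight_nonneg hq e'
  · obtain ⟨m, rfl⟩ := ENat.ne_top_iff_exists.1 he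
    rw [expWeight_natCast, ← pow_succ']
    exact pow_le_expWeight hq hq1 (by exact_mod_cast h)

theorem edist_le_succ {x y : V} {s : ℕ} (h : G.edist x y ≤ (s + 1 : ℕ)) :
    x = y ∨ ∃ z, G.Adj x z ∧ G.edist z y ≤ s := by
  obtain ⟨p, hp⟩ := G.exists_walk_of_edist_ne_top (ne_top_of_le_ne_top (ENat.natCast_ne_top _) h)
  cases p with
  | nil => exact Or.inl rfl
  | cons hadj p =>
    refine Or.inr ⟨_, hadj, (G.edist_le p).trans ?_⟩
    rw [← hp, SimpleGraph.Walk.length_cons] at h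
    have : p.length + 1 ≤ s + 1 := by exact_mod_cast h
    exact_mod_cast (by omega : p.length ≤ s)

theorem edist_le_add {x y z : V} {a b c : ℕ} (h : G.edist x y ≤ a) (h' : G.edist y z ≤ b)
    (hc : a + b ≤ c) : G.edist x z ≤ c :=
  (G.edist_triangle.trans (add_le_add h h')).trans (by exact_mod_cast hc)

theorem edist_le_one_of_adj {x y : V} (h : G.Adj x y) : G.edist x y ≤ (1 : ℕ) := by
  simpa using G.edist_le h.toWalk

theorem exists_finset_closedBall {d : ℕ} (hG : DegreeBound G d) (x : V) (s : ℕ) :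
    ∃ t : Finset V, (t : Set V) = closedBall G x s ∧ t.card ≤ (d + 1) ^ s := by
  have hfin : ∀ y, (G.neighborSet y).Finite := fun y =>
    Set.finite_of_encard_le_coe (hG y)
  have hcard : ∀ y, (insert y (hfin y).toFinset).card ≤ d + 1 := fun y => by
    refine (Finset.card_insert_le _ _).trans (Nat.succ_le_succ ?_)
    have := hG y
    rw [(hfin y).encard_eq_coe_toFinset_card] at this
    exact_mod_cast this
  induction s with
  | zero =>
    refine ⟨{x}, ?_, by simp⟩
    ext y
    simp [closedBall, eq_comm (a := y)]
  | succ s ih =>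
    obtain ⟨t, ht, hc⟩ := ih
    have ht' : ∀ y, y ∈ t ↔ G.edist x y ≤ s := fun y => by
      rw [← Finset.mem_coe, ht]
      rfl
    refine ⟨t.biUnion fun y => insert y (hfin y).toFinset, ?_, ?_⟩
    · ext y
      simp only [Finset.coe_biUnion, Set.mem_iUnion, Finset.coe_insert, Set.Finite.coe_toFinset,
        Set.mem_insert_iff, SimpleGraph.mem_neighborSet, exists_prop]
      have hy : y ∈ closedBall G x (s + 1) ↔ G.edist x y ≤ (s + 1 : ℕ) := Iff.rfl
      simp only [hy, Finset.mem_coe, ht']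
      constructor
      · rintro ⟨z, hz, rfl | h⟩
        · exact hz.trans (by exact_mod_cast Nat.le_succ s)
        · exact edist_le_add hz (edist_le_one_of_adj h) le_rfl
      · intro h
        rw [SimpleGraph.edist_comm] at h
        rcases edist_le_succ h with rfl | ⟨z, hz, h⟩
        · exact ⟨y, by simp, Or.inl rfl⟩
        · exact ⟨z, by rwa [SimpleGraph.edist_comm], Or.inr hz.symm⟩
    · rw [pow_succ]
      exact (Finset.card_biUnion_le_card_mul _ _ _ fun y _ => hcard y).trans
        (Nat.mul_le_mul_right _ hc)

variable [Fintype V]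

/-- The ball of radius `s` around `x` as a finset. -/
noncomputable def fball (G : SimpleGraph V) (x : V) (s : ℕ) : Finset V :=
  Finset.univ.filter fun y => G.edist x y ≤ s

theorem mem_fball {x y : V} {s : ℕ} : y ∈ fball G x s ↔ G.edist x y ≤ s := by
  simp [fball]

theorem coe_fball (x : V) (s : ℕ) : (fball G x s : Set V) = closedBall G x s := by
  ext; simp [fball, closedBall]

theorem card_fball_le {d : ℕ} (hG : DegreeBound G d) (x : V) (s : ℕ) :
    (fball G x s).card ≤ (d + 1) ^ s := by
  obtain ⟨t, ht, hc⟩ := exists_finset_closedBall hG x s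
  rwa [← Finset.coe_injective (ht.trans (coe_fball x s).symm)]

theorem card_fball_two_pow_le {d D : ℕ} (hG : DegreeBound G d) (hD : IsDoubling G D) (x : V)
    (n : ℕ) : (fball G x (2 ^ n)).card ≤ D ^ n * (d + 1) := by
  induction n with
  | zero => simpa using card_fball_le hG x 1
  | succ n ih =>
    have h := hD x (2 ^ n) Nat.one_le_two_pow
    rw [← coe_fball, ← coe_fball, Set.encard_coe_eq_coe_finsetCard,
      Set.encard_coe_eq_coe_finsetCard] at h
    have h' : (fball G x (2 * 2 ^ n)).card ≤ D * (fball G x (2 ^ n)).card := by exact_mod_cast h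
    rw [pow_succ', pow_succ', mul_assoc]
    exact h'.trans (Nat.mul_le_mul_left _ ih)

/-- Doubling from the next power of two downwards gives a power of `D`; the crude bound `D ≤ 2 ^ D`
turns it into a polynomial in `t` of degree `D`. -/
theorem card_fball_le_poly {d D : ℕ} (hG : DegreeBound G d) (hD : IsDoubling G D) (x : V)
    {t : ℕ} (ht : 1 ≤ t) : (fball G x t).card ≤ (2 * t) ^ D * (d + 1) := by
  have h1 : fball G x t ⊆ fball G x (2 ^ (Nat.log 2 t + 1)) := fun y hy => by
    rw [mem_fball] at hy ⊢
    exact hy.trans (by exact_mod_cast (Nat.lt_pow_succ_log_self one_lt_two t).le)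
  refine (Finset.card_le_card h1).trans ((card_fball_two_pow_le hG hD x _).trans
    (Nat.mul_le_mul_right _ ?_))
  calc D ^ (Nat.log 2 t + 1) ≤ (2 ^ D) ^ (Nat.log 2 t + 1) :=
        Nat.pow_le_pow_left Nat.lt_two_pow_self.le _
    _ = (2 * 2 ^ Nat.log 2 t) ^ D := by rw [← pow_succ', ← pow_mul, ← pow_mul, mul_comm]
    _ ≤ (2 * t) ^ D :=
        Nat.pow_le_pow_left (Nat.mul_le_mul_left _ (Nat.pow_log_le_self 2 (by omega))) _

end Growth

open scoped Classical in
/-- In doubling graphs, exponential weights have uniformly small tails. -/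
theorem exists_tail_bound (d D : ℕ) {q : ℝ} (hq : 0 < q) (hq1 : q < 1) {δ : ℝ} (hδ : 0 < δ) :
    ∃ L : ℕ, ∀ (V : Type u) [Fintype V] (G : SimpleGraph V), DegreeBound G d → IsDoubling G D →
      ∀ (x : V) (R : ℕ), L ≤ R →
        ∑ y with ¬ G.edist x y ≤ R, expWeight q (G.edist x y) ≤ δ := by
  -- A sphere of radius `t` contributes at most the volume of its ball times `q ^ t`. The resulting
  -- series depends only on `d`, `D` and `q`, which makes the tail bound uniform over all graphs.
  have hsum : Summable fun t : ℕ => ((2 * t) ^ D * (d + 1) : ℝ) * q ^ t := by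
    have := (summable_pow_mul_geometric_of_norm_lt_one D
      (by rwa [Real.norm_of_nonneg hq.le] : ‖q‖ < 1)).mul_left ((2 : ℝ) ^ D * (d + 1))
    refine this.congr fun t => ?_
    rw [mul_pow]; ring
  obtain ⟨s, hs⟩ := summable_iff_vanishing_norm.1 hsum δ hδ
  refine ⟨s.sup id, fun V _ G hG hD x R hR => ?_⟩
  let M := Finset.univ.sup (fun y => (G.edist x y).toNat) + 1
  let P : Finset V := Finset.univ.filter fun y => ¬ G.edist x y ≤ R ∧ G.edist x y ≠ ⊤
  have h1 : ∑ y with ¬ G.edist x y ≤ R, expWeight q (G.edist x y)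
      = ∑ y ∈ P, expWeight q (G.edist x y) := by
    symm
    refine Finset.sum_subset (fun y hy => ?_) fun y hy hy' => ?_
    · simp only [P, Finset.mem_filter] at hy ⊢
      exact ⟨hy.1, hy.2.1⟩
    · simp only [P, Finset.mem_filter, Finset.mem_univ, true_and, not_and, not_not] at hy hy'
      simp [expWeight, hy' hy]
  have hmaps : ∀ y ∈ P, (G.edist x y).toNat ∈ Finset.Ico (R + 1) M := fun y hy => by
    simp only [P, Finset.mem_filter, Finset.mem_univ, true_and] at hy
    obtain ⟨m, hm⟩ := ENat.ne_top_iff_exists.1 hy.2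
    have h2 : (G.edist x y).toNat ≤ Finset.univ.sup (fun y => (G.edist x y).toNat) :=
      Finset.le_sup (f := fun y => (G.edist x y).toNat) (Finset.mem_univ y)
    have h3 : R < m := by
      rw [← hm] at hy; exact_mod_cast not_le.1 hy.1
    rw [Finset.mem_Ico]
    refine ⟨?_, by omega⟩
    rw [← hm]; exact h3
  rw [h1, ← Finset.sum_fiberwise_of_maps_to hmaps]
  have h2 : ∀ t ∈ Finset.Ico (R + 1) M,
      ∑ y ∈ P with (G.edist x y).toNat = t, expWeight q (G.edist x y)
        ≤ ((2 * t) ^ D * (d + 1) : ℝ) * q ^ t := fun t ht => by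
    have h3 : ∀ y ∈ P.filter fun y => (G.edist x y).toNat = t,
        expWeight q (G.edist x y) = q ^ t := fun y hy => by
      simp only [P, Finset.mem_filter, Finset.mem_univ, true_and] at hy
      rw [expWeight, if_neg hy.1.2, hy.2]
    rw [Finset.sum_congr rfl h3, Finset.sum_const, nsmul_eq_mul]
    refine mul_le_mul_of_nonneg_right ?_ (by positivity)
    have h4 : (P.filter fun y => (G.edist x y).toNat = t) ⊆ fball G x t := fun y hy => by
      simp only [P, Finset.mem_filter, Finset.mem_univ, true_and] at hy
      rw [mem_fball, ← hy.2, ENat.natCast_toNat hy.1.2]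
    have h5 := (Finset.card_le_card h4).trans
      (card_fball_le_poly hG hD x (t := t) (by rw [Finset.mem_Ico] at ht; omega))
    exact_mod_cast h5
  refine (Finset.sum_le_sum h2).trans ((le_abs_self _).trans (hs _ ?_).le)
  rw [Finset.disjoint_left]
  intro t ht hts
  have : t ≤ s.sup id := Finset.le_sup (f := id) hts
  rw [Finset.mem_Ico] at ht
  omega

open scoped Classical in
theorem exists_mass_bound (d D : ℕ) {q : ℝ} (hq : 0 < q) (hq1 : q < 1) :
    ∃ C : ℝ, 0 < C ∧ ∀ (V : Type u) [Fintype V] (G : SimpleGraph V), DegreeBound G d →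
      IsDoubling G D → ∀ x : V, ∑ y, expWeight q (G.edist x y) ≤ C := by
  obtain ⟨L, hL⟩ := exists_tail_bound.{u} d D hq hq1 one_pos
  refine ⟨(d + 1 : ℝ) ^ L + 1, by positivity, fun V _ G hG hD x => ?_⟩
  rw [← Finset.sum_filter_add_sum_filter_not Finset.univ fun y => G.edist x y ≤ L]
  refine add_le_add ?_ (hL V G hG hD x L le_rfl)
  refine (Finset.sum_le_card_nsmul _ _ 1 fun y _ => expWeight_le_one hq.le hq1.le _).trans ?_
  have := card_fball_le hG x L
  rw [nsmul_one]
  exact_mod_cast this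

end LocalMIS

namespace LocalMIS

/-! ### Slowly varying functions and the normalised kernel -/

section Slow

variable {V : Type u} {G : SimpleGraph V}

/-- A function that decreases at most by the factor `r` along each edge. -/
def IsSlow (G : SimpleGraph V) (r : ℝ) (F : V → ℝ) : Prop :=
  ∀ y z, G.Adj y z → r * F y ≤ F z

theorem IsSlow.pow_mul_le {r : ℝ} {F : V → ℝ} (h : IsSlow G r F) (hr : 0 ≤ r) (hr1 : r ≤ 1)
    (hF : ∀ y, 0 ≤ F y) {n : ℕ} {y z : V} (hyz : G.edist y z ≤ n) : r ^ n * F y ≤ F z := by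
  induction n generalizing y with
  | zero =>
    have : y = z := by simpa using hyz
    simp [this]
  | succ n ih =>
    rcases edist_le_succ hyz with rfl | ⟨w, hw, hwz⟩
    · exact mul_le_of_le_one_left (hF y) (pow_le_one₀ hr hr1)
    · calc r ^ (n + 1) * F y = r ^ n * (r * F y) := by ring
        _ ≤ r ^ n * F w := mul_le_mul_of_nonneg_left (h _ _ hw) (by positivity)
        _ ≤ F z := ih hwz

theorem IsSlow.mul {r s : ℝ} {F H : V → ℝ} (hF : IsSlow G r F) (hH : IsSlow G s H)
    (hs : 0 ≤ s) (hF0 : ∀ y, 0 ≤ F y) (hH0 : ∀ y, 0 ≤ H y) :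
    IsSlow G (r * s) fun y => F y * H y := fun y z hyz => by
  calc r * s * (F y * H y) = (r * F y) * (s * H y) := by ring
    _ ≤ F z * H z :=
      mul_le_mul (hF y z hyz) (hH y z hyz) (mul_nonneg hs (hH0 y)) (hF0 z)

theorem edist_le_edist_add_one_of_adj (x : V) {y z : V} (h : G.Adj y z) :
    G.edist x z ≤ G.edist x y + 1 :=
  G.edist_triangle.trans (by gcongr; simpa using edist_le_one_of_adj h)

theorem isSlow_expWeight {q : ℝ} (hq : 0 ≤ q) (hq1 : q ≤ 1) (x : V) :
    IsSlow G q fun y => expWeight q (G.edist x y) := fun _ _ h =>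
  mul_expWeight_le hq hq1 (edist_le_edist_add_one_of_adj x h)

variable [Fintype V]

/-- The total weight of all vertices as seen from `y`. -/
noncomputable def mass (G : SimpleGraph V) (q : ℝ) (y : V) : ℝ := ∑ z, expWeight q (G.edist y z)

theorem one_le_mass {q : ℝ} (hq : 0 ≤ q) (y : V) : 1 ≤ mass G q y := by
  have := Finset.single_le_sum (f := fun z => expWeight q (G.edist y z))
    (fun z _ => expWeight_nonneg hq _) (Finset.mem_univ y)
  simpa [expWeight, mass] using this

theorem isSlow_mass {q : ℝ} (hq : 0 ≤ q) (hq1 : q ≤ 1) : IsSlow G q (mass G q) := fun y z h => by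
  unfold mass
  rw [Finset.mul_sum]
  refine Finset.sum_le_sum fun w _ => ?_
  rw [G.edist_comm (u := y), G.edist_comm (u := z)]
  exact isSlow_expWeight hq hq1 w y z h

/-- The weight of `y` as seen from `x`, normalised so that the weights of `y` sum to `1`. -/
noncomputable def kernel (G : SimpleGraph V) (q : ℝ) (x y : V) : ℝ :=
  expWeight q (G.edist x y) / mass G q y

theorem kernel_nonneg {q : ℝ} (hq : 0 ≤ q) (x y : V) : 0 ≤ kernel G q x y :=
  div_nonneg (expWeight_nonneg hq _) (zero_le_one.trans (one_le_mass hq y))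

theorem kernel_le {q : ℝ} (hq : 0 ≤ q) (x y : V) : kernel G q x y ≤ expWeight q (G.edist x y) :=
  div_le_self (expWeight_nonneg hq _) (one_le_mass hq y)

theorem sum_kernel {q : ℝ} (hq : 0 ≤ q) (y : V) : ∑ x, kernel G q x y = 1 := by
  unfold kernel
  rw [← Finset.sum_div, div_eq_one_iff_eq (zero_lt_one.trans_le (one_le_mass hq y)).ne']
  exact Finset.sum_congr rfl fun x _ => by rw [G.edist_comm]

/-- Both the weight and the normalising mass change by at most a factor `q` along an edge, and these
losses multiply. -/
theorem isSlow_kernel {q : ℝ} (hq : 0 < q) (hq1 : q ≤ 1) (x : V) :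
    IsSlow G (q * q) (kernel G q x) := fun y z h => by
  have hy := zero_lt_one.trans_le (one_le_mass (G := G) hq.le y)
  have hz := zero_lt_one.trans_le (one_le_mass (G := G) hq.le z)
  unfold kernel
  rw [← mul_div_assoc, div_le_div_iff₀ hy hz]
  calc q * q * expWeight q (G.edist x y) * mass G q z
      = (q * expWeight q (G.edist x y)) * (q * mass G q z) := by ring
    _ ≤ expWeight q (G.edist x z) * mass G q y :=
      mul_le_mul (isSlow_expWeight hq.le hq1 x y z h) (isSlow_mass hq.le hq1 z y h.symm)
        (mul_nonneg hq.le hz.le) (expWeight_nonneg hq.le _)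

end Slow

/-! ### Layer-cake comparison of sums -/

section LayerCake

open MeasureTheory

/-- Comparison of sums by comparison of the sizes of superlevel sets. -/
theorem sum_le_mul_sum_of_card_superlevel_le {α : Type*} (S T : Finset α) (f g : α → ℝ)
    (hf : ∀ y, 0 ≤ f y) (hg : ∀ y, 0 ≤ g y) {c : ℝ} (hc : 0 ≤ c)
    (h : ∀ s : ℝ, 0 < s → ((T.filter fun y => s ≤ f y).card : ℝ)
      ≤ c * (S.filter fun y => s ≤ g y).card) :
    ∑ y ∈ T, f y ≤ c * ∑ y ∈ S, g y := by
  have key : ∀ (U : Finset α) (k : α → ℝ), (∀ y, 0 ≤ k y) →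
      ENNReal.ofReal (∑ y ∈ U, k y)
        = ∫⁻ s in Set.Ioi (0 : ℝ), ((U.filter fun y => s ≤ k y).card : ENNReal) := by
    intro U k hk
    rw [ENNReal.ofReal_sum_of_nonneg fun y _ => hk y]
    have : ∀ s : ℝ, ((U.filter fun y => s ≤ k y).card : ENNReal)
        = ∑ y ∈ U, (Set.Iic (k y)).indicator (fun _ => 1) s := fun s => by
      rw [Finset.card_filter]
      push_cast
      exact Finset.sum_congr rfl fun y _ => by simp [Set.indicator_apply]
    simp_rw [this]
    rw [lintegral_finsetSum _ fun y _ => measurable_const.indicator measurableSet_Iic]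
    refine Finset.sum_congr rfl fun y _ => ?_
    rw [lintegral_indicator measurableSet_Iic, setLIntegral_const, one_mul,
      Measure.restrict_apply measurableSet_Iic, Set.inter_comm, Set.Ioi_inter_Iic, Real.volume_Ioc,
      sub_zero]
  rw [← ENNReal.ofReal_le_ofReal_iff (mul_nonneg hc (Finset.sum_nonneg fun y _ => hg y)),
    ENNReal.ofReal_mul hc, key T f hf, key S g hg,
    ← lintegral_const_mul' _ _ ENNReal.ofReal_ne_top]
  refine setLIntegral_mono' measurableSet_Ioi fun s hs => ?_
  rw [← ENNReal.ofReal_natCast, ← ENNReal.ofReal_natCast, ← ENNReal.ofReal_mul hc]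
  exact ENNReal.ofReal_le_ofReal (h s hs)

end LayerCake

/-! ### Profitable exchanges and local optimality -/

section Exchange

open scoped Classical

variable {V : Type u} [Fintype V] {G : SimpleGraph V}

/-- No two vertices of `I` are adjacent. -/
def Indep (G : SimpleGraph V) (I : Finset V) : Prop := ∀ y ∈ I, ∀ z ∈ I, ¬ G.Adj y z

/-- The vertices adjacent to some vertex of `I`. -/
noncomputable def nbr (G : SimpleGraph V) (I : Finset V) : Finset V :=
  Finset.univ.filter fun y => ∃ z ∈ I, G.Adj z y

theorem mem_nbr {I : Finset V} {y : V} : y ∈ nbr G I ↔ ∃ z ∈ I, G.Adj z y := by simp [nbr]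

/-- Adding `I` to `S` and removing the neighbours of `I` from `S` is an improvement by the
factor `c`. -/
structure Improving (G : SimpleGraph V) (c : ℝ) (S I : Finset V) : Prop where
  indep : Indep G I
  notMem : ∀ y ∈ I, y ∉ S
  nonempty : I.Nonempty
  card_le : c * (S ∩ nbr G I).card ≤ I.card

/-- Up to powers of `r`, `F` equals `F v` on `I` and its neighbours, so the gain in cardinality
becomes a gain in weight. The condition on `κ` says that the factor `c` outweighs the variation of
`F` and still leaves `κ * F v`. -/
theorem Improving.sum_add_le {c : ℝ} {S I : Finset V} (h : Improving G c S I) {r : ℝ} (hr : 0 < r)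
    (hr1 : r ≤ 1) {F : V → ℝ} (hF0 : ∀ y, 0 ≤ F y) (hF : IsSlow G r F) {K : ℕ} {v : V}
    (hI : I ⊆ fball G v K) (hc : 0 ≤ c) {κ : ℝ} (hκ : 0 ≤ κ) (hκc : 1 ≤ (r ^ K - κ) * (c * r ^ (K + 1))) :
    κ * F v + ∑ y ∈ S ∩ nbr G I, F y ≤ ∑ y ∈ I, F y := by
  have h1 : (I.card : ℝ) * (r ^ K * F v) ≤ ∑ y ∈ I, F y := by
    rw [← nsmul_eq_mul]
    exact Finset.card_nsmul_le_sum _ _ _ fun y hy =>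
      hF.pow_mul_le hr.le hr1 hF0 (mem_fball.1 (hI hy))
  have hp : 0 < r ^ (K + 1) := by positivity
  have h2 : r ^ (K + 1) * ∑ y ∈ S ∩ nbr G I, F y ≤ (S ∩ nbr G I).card * F v := by
    rw [Finset.mul_sum, ← nsmul_eq_mul]
    refine Finset.sum_le_card_nsmul _ _ _ fun y hy => ?_
    obtain ⟨z, hz, hzy⟩ := mem_nbr.1 (Finset.mem_inter.1 hy).2
    refine hF.pow_mul_le hr.le hr1 hF0 ?_
    rw [G.edist_comm]
    exact edist_le_add (mem_fball.1 (hI hz)) (edist_le_one_of_adj hzy) le_rfl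
  have h3 : (1 : ℝ) ≤ I.card := by exact_mod_cast h.nonempty.card_pos
  have hFv := hF0 v
  set a : ℝ := (I.card : ℝ)
  set b : ℝ := ((S ∩ nbr G I).card : ℝ)
  have h4 : c * b ≤ a := h.card_le
  have hu : 0 ≤ r ^ K - κ := by
    by_contra hcon
    have : (r ^ K - κ) * (c * r ^ (K + 1)) ≤ 0 :=
      mul_nonpos_of_nonpos_of_nonneg (not_le.1 hcon).le (mul_nonneg hc hp.le)
    linarith
  set X := ∑ y ∈ S ∩ nbr G I, F y
  have hX : 0 ≤ X := Finset.sum_nonneg fun y _ => hF0 y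
  have h5 : X ≤ (r ^ K - κ) * (a * F v) :=
    calc X ≤ (r ^ K - κ) * (c * r ^ (K + 1)) * X := le_mul_of_one_le_left hX hκc
      _ ≤ (r ^ K - κ) * (a * F v) := by
        rw [mul_assoc]
        refine mul_le_mul_of_nonneg_left ?_ hu
        calc c * r ^ (K + 1) * X = c * (r ^ (K + 1) * X) := by ring
          _ ≤ c * (b * F v) := mul_le_mul_of_nonneg_left h2 hc
          _ = c * b * F v := by ring
          _ ≤ a * F v := mul_le_mul_of_nonneg_right h4 hFv
  nlinarith [mul_nonneg (mul_nonneg hκ hFv) (sub_nonneg.2 h3)]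

/-- If no subset of a ball can be exchanged with profit, then slowly varying sums over independent
subsets of the ball are not much larger than over `S`. -/
theorem sum_inter_fball_le {c : ℝ} (hc : 1 ≤ c) {S T : Finset V} (hT : Indep G T) {v : V} {K : ℕ}
    (hI : ∀ I ⊆ fball G v K, ¬ Improving G c S I) {r : ℝ} (hr : 0 < r) (hr1 : r ≤ 1) {H : V → ℝ}
    (hH0 : ∀ y, 0 ≤ H y) (hH : IsSlow G r H) :
    r * ∑ y ∈ T ∩ fball G v K, H y ≤ c * ∑ y ∈ S, H y := by
  -- A Hall-type inequality. The part `A \ S` is bounded because it is not a profitable exchange,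
  -- and `A ∩ S` is counted directly using `1 ≤ c`. The two parts of `S` used are disjoint because
  -- `A` is independent.
  have key : ∀ A ⊆ T ∩ fball G v K, (A.card : ℝ) ≤ c * (S ∩ (A ∪ nbr G A)).card := by
    intro A hA
    have hAT : Indep G A := fun y hy z hz =>
      hT y (Finset.mem_inter.1 (hA hy)).1 z (Finset.mem_inter.1 (hA hz)).1
    have h1 : ((A \ S).card : ℝ) ≤ c * (S ∩ nbr G (A \ S)).card := by
      by_contra hlt
      rw [not_le] at hlt
      refine hI (A \ S) (Finset.sdiff_subset.trans (hA.trans Finset.inter_subset_right)) ⟨?_, ?_, ?_, hlt.le⟩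
      · exact fun y hy z hz => hAT y (Finset.mem_sdiff.1 hy).1 z (Finset.mem_sdiff.1 hz).1
      · exact fun y hy => (Finset.mem_sdiff.1 hy).2
      · rw [← Finset.card_pos]
        have : (0 : ℝ) < (A \ S).card := lt_of_le_of_lt (by positivity) hlt
        exact_mod_cast this
    have h2 : (A.card : ℝ) = (A ∩ S).card + (A \ S).card := by
      exact_mod_cast (Finset.card_inter_add_card_sdiff A S).symm
    have h3 : (((A ∩ S).card : ℝ) + (S ∩ nbr G (A \ S)).card) ≤ (S ∩ (A ∪ nbr G A)).card := by
      rw [← Nat.cast_add, ← Finset.card_union_of_disjoint]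
      · refine Nat.cast_le.2 (Finset.card_le_card fun y hy => ?_)
        simp only [Finset.mem_union, Finset.mem_inter, mem_nbr, Finset.mem_sdiff] at hy ⊢
        rcases hy with hy | ⟨hy, z, hz, hzy⟩
        · exact ⟨hy.2, Or.inl hy.1⟩
        · exact ⟨hy, Or.inr ⟨z, hz.1, hzy⟩⟩
      · rw [Finset.disjoint_left]
        intro y hy hy'
        obtain ⟨z, hz, hzy⟩ := mem_nbr.1 (Finset.mem_inter.1 hy').2
        exact hAT z (Finset.mem_sdiff.1 hz).1 y (Finset.mem_inter.1 hy).1 hzy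
    have h4 : (0 : ℝ) ≤ (A ∩ S).card := by positivity
    nlinarith
  -- For `A` a superlevel set of `H`, neighbours of `A` lie in the superlevel set of `r⁻¹ * H` at
  -- the same height, by slowness.
  have := sum_le_mul_sum_of_card_superlevel_le S (T ∩ fball G v K) H (fun y => r⁻¹ * H y) hH0
    (fun y => mul_nonneg (inv_nonneg.2 hr.le) (hH0 y)) (zero_le_one.trans hc) fun s _ => by
      refine (key _ (Finset.filter_subset _ _)).trans
        (mul_le_mul_of_nonneg_left (Nat.cast_le.2 (Finset.card_le_card fun y hy => ?_))
          (zero_le_one.trans hc))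
      simp only [Finset.mem_inter, Finset.mem_union, mem_nbr, Finset.mem_filter] at hy ⊢
      refine ⟨hy.1, ?_⟩
      rw [le_inv_mul_iff₀ hr]
      rcases hy.2 with ⟨_, hy⟩ | ⟨z, ⟨_, hz⟩, hzy⟩
      · nlinarith [hH0 y]
      · exact (mul_le_mul_of_nonneg_left hz hr.le).trans (hH z y hzy)
  rw [← Finset.mul_sum] at this
  calc _ ≤ r * (c * (r⁻¹ * ∑ y ∈ S, H y)) := mul_le_mul_of_nonneg_left this hr.le
    _ = _ := by field_simp

/-- If no small set near `x` can be exchanged with profit, then slowly varying sums over independent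
sets near `x` are not much larger than over `S`. -/
theorem sum_inter_fball_le_of_tail {c : ℝ} (hc : 1 ≤ c) {S T : Finset V} (hT : Indep G T) {x : V}
    {K R : ℕ} (hI : ∀ v, G.edist x v ≤ (R + K : ℕ) → ∀ I ⊆ fball G v K, ¬ Improving G c S I)
    {q : ℝ} (hq : 0 < q) (hq1 : q ≤ 1) {δ : ℝ}
    (hδ : ∀ y, ∑ v with ¬ G.edist y v ≤ K, expWeight q (G.edist y v) ≤ δ)
    {r : ℝ} (hr : 0 < r) (hr1 : r ≤ 1) {F : V → ℝ} (hF0 : ∀ y, 0 ≤ F y) (hF : IsSlow G r F) :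
    r * (q * q) * ((1 - δ) * ∑ y ∈ T ∩ fball G x R, F y) ≤ c * ∑ y ∈ S, F y := by
  have hk0 : ∀ v y, 0 ≤ kernel G q v y := kernel_nonneg hq.le
  -- Multiplying `F` by a kernel centred at `v` localises the sum without losing slowness. Summing
  -- over `v` then recovers `F` up to the kernel's tail beyond distance `K`.
  have h1 : ∀ v ∈ fball G x (R + K), r * (q * q) * ∑ y ∈ T ∩ fball G v K, F y * kernel G q v y
      ≤ c * ∑ y ∈ S, F y * kernel G q v y := fun v hv =>
    sum_inter_fball_le hc hT (hI v (mem_fball.1 hv)) (by positivity)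
      (mul_le_one₀ hr1 (by positivity) (mul_le_one₀ hq1 hq.le hq1))
      (fun y => mul_nonneg (hF0 y) (hk0 v y))
      (hF.mul (isSlow_kernel hq hq1 v) (by positivity) hF0 (hk0 v))
  have h2 : ∑ v ∈ fball G x (R + K), ∑ y ∈ S, F y * kernel G q v y ≤ ∑ y ∈ S, F y := by
    calc _ ≤ ∑ v, ∑ y ∈ S, F y * kernel G q v y :=
          Finset.sum_le_sum_of_subset_of_nonneg (Finset.subset_univ _) fun v _ _ =>
            Finset.sum_nonneg fun y _ => mul_nonneg (hF0 y) (hk0 v y)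
      _ = ∑ y ∈ S, F y := by
          rw [Finset.sum_comm]
          exact Finset.sum_congr rfl fun y _ => by rw [← Finset.mul_sum, sum_kernel hq.le, mul_one]
  have h4 : ∀ y, 1 - δ ≤ ∑ v ∈ fball G y K, kernel G q v y := fun y => by
    have h5 := sum_kernel (G := G) hq.le y
    rw [← Finset.sum_filter_add_sum_filter_not Finset.univ fun v => G.edist y v ≤ K] at h5
    have h6 : ∑ v with ¬ G.edist y v ≤ K, kernel G q v y ≤ δ :=
      (Finset.sum_le_sum fun v _ => by
        rw [G.edist_comm]; exact kernel_le hq.le v y).trans (hδ y)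
    change 1 - δ ≤ ∑ v with G.edist y v ≤ K, kernel G q v y
    linarith
  have h3 : (1 - δ) * ∑ y ∈ T ∩ fball G x R, F y
      ≤ ∑ v ∈ fball G x (R + K), ∑ y ∈ T ∩ fball G v K, F y * kernel G q v y := by
    calc (1 - δ) * ∑ y ∈ T ∩ fball G x R, F y
        ≤ ∑ y ∈ T ∩ fball G x R, ∑ v ∈ fball G y K, F y * kernel G q v y := by
          rw [Finset.mul_sum]
          refine Finset.sum_le_sum fun y _ => ?_
          rw [← Finset.mul_sum, mul_comm]
          exact mul_le_mul_of_nonneg_left (h4 y) (hF0 y)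
      _ = ∑ v, ∑ y ∈ T ∩ fball G x R with v ∈ fball G y K, F y * kernel G q v y :=
          Finset.sum_comm' fun y v => by simp
      _ = ∑ v ∈ fball G x (R + K), ∑ y ∈ T ∩ fball G x R with v ∈ fball G y K,
            F y * kernel G q v y := by
          symm
          refine Finset.sum_subset (Finset.subset_univ _) fun v _ hv => ?_
          refine Finset.sum_eq_zero fun y hy => absurd ?_ hv
          simp only [Finset.mem_filter, Finset.mem_inter, mem_fball] at hy ⊢
          exact edist_le_add hy.1.2 hy.2 le_rfl
      _ ≤ _ := by
          refine Finset.sum_le_sum fun v _ => ?_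
          refine Finset.sum_le_sum_of_subset_of_nonneg (fun y hy => ?_) fun y _ _ =>
            mul_nonneg (hF0 y) (hk0 v y)
          simp only [Finset.mem_filter, Finset.mem_inter, mem_fball] at hy ⊢
          exact ⟨hy.1.1, by rw [G.edist_comm]; exact hy.2⟩
  calc r * (q * q) * ((1 - δ) * ∑ y ∈ T ∩ fball G x R, F y)
      ≤ r * (q * q) * ∑ v ∈ fball G x (R + K), ∑ y ∈ T ∩ fball G v K, F y * kernel G q v y :=
        mul_le_mul_of_nonneg_left h3 (by positivity)
    _ ≤ c * ∑ v ∈ fball G x (R + K), ∑ y ∈ S, F y * kernel G q v y := by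
        rw [Finset.mul_sum, Finset.mul_sum]
        exact Finset.sum_le_sum h1
    _ ≤ c * ∑ y ∈ S, F y := mul_le_mul_of_nonneg_left h2 (zero_le_one.trans hc)

end Exchange

end LocalMIS

namespace LocalMIS

theorem sum_biUnion_le {α β : Type*} [DecidableEq β] (s : Finset α) (t : α → Finset β) {f : β → ℝ}
    (hf : ∀ y, 0 ≤ f y) : ∑ y ∈ s.biUnion t, f y ≤ ∑ x ∈ s, ∑ y ∈ t x, f y := by
  classical
  induction s using Finset.induction_on with
  | empty => simp
  | insert a s ha ih =>
    rw [Finset.biUnion_insert, Finset.sum_insert ha]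
    have h1 := Finset.sum_union_inter (s₁ := t a) (s₂ := s.biUnion t) (f := f)
    have h2 : 0 ≤ ∑ y ∈ t a ∩ s.biUnion t, f y := Finset.sum_nonneg fun y _ => hf y
    linarith

/-! ### The local search and its potentials -/

section LocalSearch

open scoped Classical

variable {V : Type u} [Fintype V] (G : SimpleGraph V) {C : Type} (col : V → C) (K : ℕ) (c : ℝ)

/-- The vertices of the `K`-ball around `v` with colours in `A`. -/
noncomputable def piece (A : Finset C) (v : V) : Finset V :=
  (fball G v K).filter fun y => col y ∈ A

/-- The vertices of colour `p.1` at which inserting the vertices with colours in `p.2` is an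
improvement of `S`. -/
noncomputable def active (p : C × Finset C) (S : Finset V) : Finset V :=
  Finset.univ.filter fun v => col v = p.1 ∧ Improving G c S (piece G col K p.2 v)

/-- The vertices inserted in one step. -/
noncomputable def inserted (p : C × Finset C) (S : Finset V) : Finset V :=
  (active G col K c p S).biUnion (piece G col K p.2)

/-- One step of the local search. -/
noncomputable def step (p : C × Finset C) (S : Finset V) : Finset V :=
  (S \ nbr G (inserted G col K c p S)) ∪ inserted G col K c p S

/-- The local search along a sequence of instructions, starting with the empty set. -/
noncomputable def search (e : ℕ → C × Finset C) : ℕ → Finset V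
  | 0 => ∅
  | n + 1 => step G col K c (e n) (search e n)

variable {G col K c}

theorem mem_inserted {p : C × Finset C} {S : Finset V} {y : V} :
    y ∈ inserted G col K c p S ↔ ∃ v, (col v = p.1 ∧ Improving G c S (piece G col K p.2 v)) ∧
      y ∈ piece G col K p.2 v := by
  simp [inserted, active]

theorem piece_subset (A : Finset C) (v : V) : piece G col K A v ⊆ fball G v K :=
  Finset.filter_subset _ _

theorem notMem_of_mem_inserted {p : C × Finset C} {S : Finset V} {y : V}
    (hy : y ∈ inserted G col K c p S) : y ∉ S := by
  obtain ⟨v, hv, hy⟩ := mem_inserted.1 hy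
  exact hv.2.notMem y hy

theorem mem_step_iff_of_forall {p : C × Finset C} {S : Finset V} {y : V}
    (h : ∀ v ∈ active G col K c p S, ¬ G.edist v y ≤ (K + 1 : ℕ)) :
    y ∈ step G col K c p S ↔ y ∈ S := by
  have h1 : y ∉ inserted G col K c p S := fun hy => by
    obtain ⟨v, hv, hy⟩ := Finset.mem_biUnion.1 hy
    exact h v hv ((mem_fball.1 (piece_subset _ _ hy)).trans (by exact_mod_cast Nat.le_succ K))
  have h2 : y ∉ nbr G (inserted G col K c p S) := fun hy => by
    obtain ⟨z, hz, hzy⟩ := mem_nbr.1 hy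
    obtain ⟨v, hv, hz⟩ := Finset.mem_biUnion.1 hz
    exact h v hv (edist_le_add (mem_fball.1 (piece_subset _ _ hz)) (edist_le_one_of_adj hzy) le_rfl)
  simp [step, h1, h2]

variable (hcol : ∀ y z, y ≠ z → G.edist y z ≤ (2 * K + 1 : ℕ) → col y ≠ col z)
include hcol

/-- An edge between inserted pieces with centres `v` and `w` forces `d(v,w) ≤ K + 1 + K`. Equal
colours then give `v = w`, and a single piece is independent. -/
theorem indep_step (p : C × Finset C) {S : Finset V} (hS : Indep G S) :
    Indep G (step G col K c p S) := by
  intro y hy z hz hyz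
  simp only [step, Finset.mem_union, Finset.mem_sdiff] at hy hz
  rcases hy with hy | hy <;> rcases hz with hz | hz
  · exact hS y hy.1 z hz.1 hyz
  · exact hy.2 (mem_nbr.2 ⟨z, hz, hyz.symm⟩)
  · exact hz.2 (mem_nbr.2 ⟨y, hy, hyz⟩)
  · obtain ⟨v, hv, hy⟩ := mem_inserted.1 hy
    obtain ⟨w, hw, hz⟩ := mem_inserted.1 hz
    have hvw : v = w := by
      by_contra hne
      refine hcol v w hne ?_ (hv.1.trans hw.1.symm)
      have h1 := mem_fball.1 (piece_subset _ _ hy)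
      have h2 := mem_fball.1 (piece_subset _ _ hz)
      rw [G.edist_comm] at h2
      exact edist_le_add (edist_le_add h1 (edist_le_one_of_adj hyz) le_rfl) h2 (by omega)
    subst hvw
    exact hv.2.indep y hy z hz hyz

theorem indep_search (e : ℕ → C × Finset C) (n : ℕ) : Indep G (search G col K c e n) := by
  induction n with
  | zero => simp [Indep, search]
  | succ n ih => exact indep_step hcol (e n) ih

variable {r : ℝ} (hr : 0 < r) (hr1 : r ≤ 1) {F : V → ℝ} (hF0 : ∀ y, 0 ≤ F y) (hF : IsSlow G r F)
  (hc : 0 ≤ c) {κ : ℝ} (hκ : 0 ≤ κ) (hκc : 1 ≤ (r ^ K - κ) * (c * r ^ (K + 1)))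
include hr hr1 hF0 hF hc hκ hκc

/-- Pieces with centres of the same colour are disjoint, so their gains add up. Their neighbourhoods
may overlap in `S`, but counting the removed vertices repeatedly only overestimates the loss. -/
theorem sum_add_le_sum_step (p : C × Finset C) (S : Finset V) :
    ∑ y ∈ S, F y + κ * ∑ v ∈ active G col K c p S, F v ≤ ∑ y ∈ step G col K c p S, F y := by
  set U := inserted G col K c p S with hU
  set B := active G col K c p S with hB
  have h1 : ∑ y ∈ step G col K c p S, F y = ∑ y ∈ S \ nbr G U, F y + ∑ y ∈ U, F y :=
    Finset.sum_union (Finset.disjoint_left.2 fun y hy hy' =>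
      notMem_of_mem_inserted hy' (Finset.mem_sdiff.1 hy).1)
  have h2 : ∑ y ∈ S ∩ nbr G U, F y + ∑ y ∈ S \ nbr G U, F y = ∑ y ∈ S, F y :=
    Finset.sum_inter_add_sum_sdiff _ _ _
  have h3 : ∑ y ∈ U, F y = ∑ v ∈ B, ∑ y ∈ piece G col K p.2 v, F y := by
    refine Finset.sum_biUnion fun v hv w hw hne => Finset.disjoint_left.2 fun y hy hy' => ?_
    have hv' := (Finset.mem_filter.1 hv).2.1
    have hw' := (Finset.mem_filter.1 hw).2.1
    refine hcol v w hne ?_ (hv'.trans hw'.symm)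
    have h1 := mem_fball.1 (piece_subset _ _ hy)
    have h2 := mem_fball.1 (piece_subset _ _ hy')
    rw [G.edist_comm] at h2
    exact edist_le_add h1 h2 (by omega)
  have h4 : ∑ y ∈ S ∩ nbr G U, F y ≤ ∑ v ∈ B, ∑ y ∈ S ∩ nbr G (piece G col K p.2 v), F y := by
    have h5 : S ∩ nbr G U = B.biUnion fun v => S ∩ nbr G (piece G col K p.2 v) := by
      ext y
      simp only [Finset.mem_inter, mem_nbr, Finset.mem_biUnion, hU, inserted]
      constructor
      · rintro ⟨hy, z, ⟨v, hv, hz⟩, hzy⟩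
        exact ⟨v, hv, hy, z, hz, hzy⟩
      · rintro ⟨v, hv, hy, z, hz, hzy⟩
        exact ⟨hy, z, ⟨v, hv, hz⟩, hzy⟩
    rw [h5]
    exact sum_biUnion_le _ _ hF0
  have h6 : ∀ v ∈ B, κ * F v + ∑ y ∈ S ∩ nbr G (piece G col K p.2 v), F y
      ≤ ∑ y ∈ piece G col K p.2 v, F y := fun v hv =>
    (Finset.mem_filter.1 hv).2.2.sum_add_le hr hr1 hF0 hF (piece_subset _ _) hc hκ hκc
  have h7 := Finset.sum_le_sum h6
  rw [Finset.sum_add_distrib, ← Finset.mul_sum] at h7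
  linarith

theorem sum_search_mono (e : ℕ → C × Finset C) :
    Monotone fun n => ∑ y ∈ search G col K c e n, F y := by
  refine monotone_nat_of_le_succ fun n => ?_
  have h := sum_add_le_sum_step hcol hr hr1 hF0 hF hc hκ hκc (e n) (search G col K c e n)
  have h' : 0 ≤ κ * ∑ v ∈ active G col K c (e n) (search G col K c e n), F v :=
    mul_nonneg hκ (Finset.sum_nonneg fun y _ => hF0 y)
  simp only [search]
  linarith

/-- By pigeonhole, during some round of the search nothing happens near `x`. -/
theorem exists_idle_round (e : ℕ → C × Finset C) {P M L : ℕ} {x : V} {β : ℝ}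
    (hβ : ∀ v, G.edist x v ≤ L → β ≤ F v) (hM : ∑ y, F y < M * (κ * β)) :
    ∃ k < M, ∀ n, k * P ≤ n → n < (k + 1) * P →
      ∀ v ∈ active G col K c (e n) (search G col K c e n), ¬ G.edist x v ≤ L := by
  by_contra hcon
  push Not at hcon
  have hmono := sum_search_mono hcol hr hr1 hF0 hF hc hκ hκc e
  -- Every round that is not idle contains an exchange near `x`, worth at least `κ * β`; `M` such
  -- rounds would exceed the total weight.
  have key : ∀ k ≤ M, k * (κ * β) ≤ ∑ y ∈ search G col K c e (k * P), F y := by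
    intro k
    induction k with
    | zero => simp [search]
    | succ k ih =>
      intro hk
      obtain ⟨n, hn1, hn2, v, hv, hxv⟩ := hcon k (by omega)
      have h1 := ih (by omega)
      have h2 := hmono hn1
      have h3 := hmono (Nat.succ_le_of_lt hn2)
      have h4 := sum_add_le_sum_step hcol hr hr1 hF0 hF hc hκ hκc (e n) (search G col K c e n)
      have h5 : κ * β ≤ κ * ∑ v ∈ active G col K c (e n) (search G col K c e n), F v :=
        mul_le_mul_of_nonneg_left ((hβ v hxv).trans
          (Finset.single_le_sum (f := F) (fun y _ => hF0 y) hv)) hκ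
      simp only [search] at h2 h3
      push_cast
      linarith
  have h1 := key M le_rfl
  have h2 : ∑ y ∈ search G col K c e (M * P), F y ≤ ∑ y, F y :=
    Finset.sum_le_sum_of_subset_of_nonneg (Finset.subset_univ _) fun y _ _ => hF0 y
  linarith

omit hcol hr hr1 hF0 hF hc hκ hκc in
theorem Improving.congr {S S' I : Finset V} (h : Improving G c S I) {v : V}
    (hI : I ⊆ fball G v K) (hS : ∀ y, G.edist v y ≤ (K + 1 : ℕ) → (y ∈ S' ↔ y ∈ S)) :
    Improving G c S' I := by
  refine ⟨h.indep, fun y hy => ?_, h.nonempty, ?_⟩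
  · rw [hS y ((mem_fball.1 (hI hy)).trans (by exact_mod_cast Nat.le_succ K))]
    exact h.notMem y hy
  · have : S' ∩ nbr G I = S ∩ nbr G I := by
      ext y
      simp only [Finset.mem_inter, mem_nbr]
      refine and_congr_left fun ⟨z, hz, hzy⟩ => hS y ?_
      exact edist_le_add (mem_fball.1 (hI hz)) (edist_le_one_of_adj hzy) le_rfl
    rw [this]
    exact h.card_le

omit hr hr1 hF0 hF hc hκ hκc in
/-- After a round that is idle near `x`, no small set near `x` can be exchanged with profit. -/
theorem not_improving_of_idle (e : ℕ → C × Finset C) {P : ℕ}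
    (he : ∀ p k, ∃ n, k * P ≤ n ∧ n < (k + 1) * P ∧ e n = p) {k L : ℕ} {x : V}
    (hidle : ∀ n, k * P ≤ n → n < (k + 1) * P →
      ∀ v ∈ active G col K c (e n) (search G col K c e n), ¬ G.edist x v ≤ (L + (2 * K + 2) : ℕ))
    {v : V} (hv : G.edist x v ≤ L) {I : Finset V} (hI : I ⊆ fball G v K) :
    ¬ Improving G c (search G col K c e (k * P)) I := by
  intro himp
  -- Within the round, this instruction attempts exactly the exchange `I` at `v`. Until then `S` is
  -- unchanged on the `(K+1)`-ball of `v`, so `v` would be active, contradicting idleness.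
  obtain ⟨n, hn1, hn2, hn⟩ := he (col v, I.image col) k
  have hsame : ∀ m, k * P ≤ m → m ≤ n → ∀ y, G.edist v y ≤ (K + 1 : ℕ) →
      (y ∈ search G col K c e m ↔ y ∈ search G col K c e (k * P)) := by
    intro m hm
    induction m, hm using Nat.le_induction with
    | base => exact fun _ _ _ => Iff.rfl
    | succ m hm ih =>
      intro hmn y hy
      rw [← ih (by omega) y hy, search]
      refine mem_step_iff_of_forall fun w hw hwy => hidle m hm (by omega) w hw ?_
      rw [G.edist_comm] at hwy
      exact edist_le_add (edist_le_add hv hy le_rfl) hwy (by omega)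
  -- Colours are injective on a `K`-ball, since its points are at mutual distance at most `2 * K`.
  have hpiece : piece G col K (I.image col) v = I := by
    ext y
    simp only [piece, Finset.mem_filter, Finset.mem_image]
    constructor
    · rintro ⟨hy, z, hz, hzy⟩
      by_contra hyI
      refine hcol z y (fun h => hyI (h ▸ hz)) ?_ hzy
      have h1 := mem_fball.1 (hI hz)
      rw [G.edist_comm] at h1
      exact edist_le_add h1 (mem_fball.1 hy) (by omega)
    · exact fun hy => ⟨hI hy, y, hy, rfl⟩
  refine hidle n hn1 hn2 v ?_ (hv.trans (by exact_mod_cast Nat.le_add_right _ _))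
  rw [active, Finset.mem_filter, hn, hpiece]
  exact ⟨Finset.mem_univ _, rfl, himp.congr hI (hsame n hn1 le_rfl)⟩

end LocalSearch

end LocalMIS

namespace LocalMIS

/-! ### Isomorphisms of balls and finiteness of ball classes -/

section Locality

variable {V V' : Type u} {G : SimpleGraph V} {G' : SimpleGraph V'}

/-- A rooted isomorphism between the balls of radius `r` around `x` and `x'`, given by maps between
the ambient vertex sets. -/
structure BallEquiv (G : SimpleGraph V) (G' : SimpleGraph V') (r : ℕ) (x : V) (x' : V') where
  f : V → V'
  g : V' → V
  f_root : f x = x'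
  f_mem : ∀ y, G.edist x y ≤ r → G'.edist x' (f y) ≤ r
  g_mem : ∀ y, G'.edist x' y ≤ r → G.edist x (g y) ≤ r
  g_f : ∀ y, G.edist x y ≤ r → g (f y) = y
  f_g : ∀ y, G'.edist x' y ≤ r → f (g y) = y
  adj : ∀ y z, G.edist x y ≤ r → G.edist x z ≤ r → (G'.Adj (f y) (f z) ↔ G.Adj y z)

namespace BallEquiv

variable {r : ℕ} {x : V} {x' : V'}

theorem root_mem : G.edist x x ≤ r := by simp

/-- The inverse of a rooted isomorphism of balls. -/
def symm (E : BallEquiv G G' r x x') : BallEquiv G' G r x' x where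
  f := E.g
  g := E.f
  f_root := (congrArg E.g E.f_root.symm).trans (E.g_f x root_mem)
  f_mem := E.g_mem
  g_mem := E.f_mem
  g_f := E.f_g
  f_g := E.g_f
  adj y z hy hz := by
    rw [← E.adj _ _ (E.g_mem y hy) (E.g_mem z hz), E.f_g y hy, E.f_g z hz]

theorem symm_f (E : BallEquiv G G' r x x') : E.symm.f = E.g := rfl

/-- The condition `a + s ≤ r` keeps a shortest path from `y` to `z` inside the ball on which
adjacency is preserved. -/
theorem edist_f_le (E : BallEquiv G G' r x x') {a s : ℕ} (has : a + s ≤ r) {y z : V}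
    (hy : G.edist x y ≤ a) (hyz : G.edist y z ≤ s) : G'.edist (E.f y) (E.f z) ≤ s := by
  induction s generalizing a y with
  | zero =>
    have : y = z := by simpa using hyz
    simp [this]
  | succ s ih =>
    rcases edist_le_succ hyz with rfl | ⟨w, hw, hwz⟩
    · simp
    · have hyw := edist_le_one_of_adj hw
      have h1 := (E.adj y w (hy.trans (by exact_mod_cast (by omega : a ≤ r)))
        (edist_le_add hy hyw (by omega))).2 hw
      exact edist_le_add (edist_le_one_of_adj h1)
        (ih (a := a + 1) (by omega) (edist_le_add hy hyw le_rfl) hwz) (by omega)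

theorem edist_f_root_le (E : BallEquiv G G' r x x') {a : ℕ} (ha : a ≤ r) {y : V}
    (hy : G.edist x y ≤ a) : G'.edist x' (E.f y) ≤ a := by
  have h := E.edist_f_le (a := 0) (y := x) (by omega) (by simp) hy
  rwa [E.f_root] at h

theorem edist_f_le_iff (E : BallEquiv G G' r x x') {a s : ℕ} (has : a + s ≤ r) {y z : V}
    (hy : G.edist x y ≤ a) (hz : G.edist x z ≤ r) :
    G'.edist (E.f y) (E.f z) ≤ s ↔ G.edist y z ≤ s := by
  refine ⟨fun h => ?_, E.edist_f_le has hy⟩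
  have h1 := E.symm.edist_f_le has (E.edist_f_root_le (by omega) hy) h
  have h2 : E.symm.f (E.f y) = y := E.g_f y (hy.trans (by exact_mod_cast (by omega : a ≤ r)))
  have h3 : E.symm.f (E.f z) = z := E.g_f z hz
  rwa [h2, h3] at h1

theorem edist_f_eq (E : BallEquiv G G' r x x') {a s : ℕ} (has : a + s ≤ r) {y z : V}
    (hy : G.edist x y ≤ a) (hyz : G.edist y z ≤ s) : G'.edist (E.f y) (E.f z) = G.edist y z := by
  have hz : G.edist x z ≤ r := edist_le_add hy hyz has
  obtain ⟨m, hm⟩ := ENat.ne_top_iff_exists.1 (ne_top_of_le_ne_top (ENat.natCast_ne_top s) hyz)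
  have h := E.edist_f_le has hy hyz
  obtain ⟨m', hm'⟩ := ENat.ne_top_iff_exists.1 (ne_top_of_le_ne_top (ENat.natCast_ne_top s) h)
  have hms : m ≤ s := by rw [← hm] at hyz; exact_mod_cast hyz
  have hms' : m' ≤ s := by rw [← hm'] at h; exact_mod_cast h
  refine le_antisymm ?_ ?_
  · rw [← hm]
    exact E.edist_f_le (by omega) hy hm.ge
  · rw [← hm']
    exact (E.edist_f_le_iff (s := m') (by omega) hy hz).1 hm'.ge

/-- A rooted isomorphism of balls restricts to smaller balls around other centres. -/
def restrict (E : BallEquiv G G' r x x') {a s : ℕ} (has : a + s ≤ r) {y : V}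
    (hy : G.edist x y ≤ a) : BallEquiv G G' s y (E.f y) where
  f := E.f
  g := E.g
  f_root := rfl
  f_mem z hz := E.edist_f_le has hy hz
  g_mem z hz := by
    have h := E.symm.edist_f_le has (E.edist_f_root_le (by omega) hy) hz
    have h2 : E.symm.f (E.f y) = y := E.g_f y (hy.trans (by exact_mod_cast (by omega : a ≤ r)))
    rwa [h2] at h
  g_f z hz := E.g_f z (edist_le_add hy hz has)
  f_g z hz := E.f_g z (edist_le_add (E.edist_f_root_le (by omega) hy) hz has)
  adj z w hz hw := E.adj z w (edist_le_add hy hz has) (edist_le_add hy hw has)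

end BallEquiv

variable {d r : ℕ} {Q : Type} {x : V} {x' : V'}

theorem exists_ballEquiv_of_ballClass_eq {hG : DegreeBound G d} {hG' : DegreeBound G' d}
    {φ : V → Q} {φ' : V' → Q} (h : ballClass hG φ r x = ballClass hG' φ' r x') :
    ∃ E : BallEquiv G G' r x x', ∀ y, G.edist x y ≤ r → φ' (E.f y) = φ y := by
  classical
  obtain ⟨e, hr, hl⟩ := Quotient.exact h
  change (G.induce (closedBall G x r)) ≃g (G'.induce (closedBall G' x' r)) at e
  change e ⟨x, _⟩ = ⟨x', _⟩ at hr
  change ∀ y : closedBall G x r, φ' (e y) = φ y at hl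
  let f : V → V' := fun y => if hy : y ∈ closedBall G x r then e ⟨y, hy⟩ else x'
  let g : V' → V := fun y => if hy : y ∈ closedBall G' x' r then e.symm ⟨y, hy⟩ else x
  have hf : ∀ y (hy : y ∈ closedBall G x r), f y = e ⟨y, hy⟩ := fun y hy => dif_pos hy
  have hg : ∀ y (hy : y ∈ closedBall G' x' r), g y = e.symm ⟨y, hy⟩ := fun y hy => dif_pos hy
  have hfm : ∀ y (hy : y ∈ closedBall G x r), f y ∈ closedBall G' x' r := fun y hy => by
    rw [hf y hy]; exact (e ⟨y, hy⟩).2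
  have hgm : ∀ y (hy : y ∈ closedBall G' x' r), g y ∈ closedBall G x r := fun y hy => by
    rw [hg y hy]; exact (e.symm ⟨y, hy⟩).2
  refine ⟨⟨f, g, ?_, hfm, hgm, ?_, ?_, ?_⟩, ?_⟩
  · rw [hf x (self_mem_closedBall G x r), hr]
  · intro y hy
    rw [hg _ (hfm y hy)]
    simp only [hf y hy, Subtype.coe_eta, RelIso.symm_apply_apply]
  · intro y hy
    rw [hf _ (hgm y hy)]
    simp only [hg y hy, Subtype.coe_eta, RelIso.apply_symm_apply]
  · intro y z hy hz
    rw [hf y hy, hf z hz]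
    exact e.map_adj_iff (v := ⟨y, hy⟩) (w := ⟨z, hz⟩)
  · intro y hy
    change φ' (f y) = φ y
    rw [hf y hy]
    exact hl ⟨y, hy⟩

theorem ballClass_eq_of_ballEquiv (hG : DegreeBound G d) (hG' : DegreeBound G' d)
    {φ : V → Q} {φ' : V' → Q} (E : BallEquiv G G' r x x')
    (hφ : ∀ y, G.edist x y ≤ r → φ' (E.f y) = φ y) :
    ballClass hG φ r x = ballClass hG' φ' r x' := by
  let e : (G.induce (closedBall G x r)) ≃g (G'.induce (closedBall G' x' r)) :=
    { toFun := fun y => ⟨E.f y, E.f_mem y y.2⟩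
      invFun := fun y => ⟨E.g y, E.g_mem y y.2⟩
      left_inv := fun y => Subtype.ext (E.g_f y y.2)
      right_inv := fun y => Subtype.ext (E.f_g y y.2)
      map_rel_iff' := fun {y z} => E.adj y z y.2 z.2 }
  exact Quotient.sound ⟨e, Subtype.ext E.f_root, fun y : closedBall G x r => hφ y y.2⟩

/-- There are finitely many rooted balls of given radius and degree bound with labels in a finite
set. -/
theorem finite_ballClass (d k : ℕ) (Q : Type) [Finite Q] : Finite (BallClass.{u} d k Q) := by
  classical
  have hemb : ∀ A : RootedBall.{u} d k Q, Nonempty (A.V ↪ Fin ((d + 1) ^ k)) := fun A => by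
    obtain ⟨t, ht, hc⟩ := exists_finset_closedBall A.degreeBound A.root k
    have hu : ∀ y, y ∈ t := fun y => by
      rw [← Finset.mem_coe, ht]; exact A.edist_root_le y
    let _ : Fintype A.V := ⟨t, hu⟩
    exact Function.Embedding.nonempty_of_card_le (by rw [Fintype.card_fin]; exact hc)
  let emb : ∀ A : RootedBall.{u} d k Q, A.V ↪ Fin ((d + 1) ^ k) := fun A => (hemb A).some
  -- After embedding the vertices into a fixed finite set, adjacency, root and labels are recorded
  -- as relations on that set. Equal codes yield an isomorphism.
  let code : RootedBall.{u} d k Q →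
      (Fin ((d + 1) ^ k) → Fin ((d + 1) ^ k) → Prop) × Fin ((d + 1) ^ k) ×
        (Fin ((d + 1) ^ k) → Q → Prop) := fun A =>
    (fun i j => ∃ a b, emb A a = i ∧ emb A b = j ∧ A.graph.Adj a b, emb A A.root,
      fun i q => ∃ a, emb A a = i ∧ A.label a = q)
  have hcode : ∀ A B, code A = code B → A ≈ B := by
    intro A B h
    simp only [code, Prod.mk.injEq] at h
    obtain ⟨hadj, hroot, hlabel⟩ := h
    have h1 : ∀ a, ∃ b, emb B b = emb A a ∧ B.label b = A.label a := fun a =>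
      (iff_of_eq (congrFun (congrFun hlabel (emb A a)) (A.label a))).1 ⟨a, rfl, rfl⟩
    have h2 : ∀ b, ∃ a, emb A a = emb B b ∧ A.label a = B.label b := fun b =>
      (iff_of_eq (congrFun (congrFun hlabel (emb B b)) (B.label b))).2 ⟨b, rfl, rfl⟩
    choose f hf hfl using h1
    choose g hg hgl using h2
    let e : A.graph ≃g B.graph :=
      { toFun := f
        invFun := g
        left_inv := fun a => (emb A).injective (by rw [hg, hf])
        right_inv := fun b => (emb B).injective (by rw [hf, hg])
        map_rel_iff' := fun {a a'} => by
          have h3 := iff_of_eq (congrFun (congrFun hadj (emb A a)) (emb A a'))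
          constructor
          · intro h
            obtain ⟨b, b', hb, hb', hbb⟩ := h3.2 ⟨f a, f a', hf a, hf a', h⟩
            rwa [(emb A).injective hb, (emb A).injective hb'] at hbb
          · intro h
            obtain ⟨b, b', hb, hb', hbb⟩ := h3.1 ⟨a, a', rfl, rfl, h⟩
            rw [← hf a] at hb
            rw [← hf a'] at hb'
            rwa [(emb B).injective hb, (emb B).injective hb'] at hbb }
    refine ⟨e, (emb B).injective ?_, hfl⟩
    exact (hf A.root).trans hroot
  refine Finite.of_injective (fun c : BallClass.{u} d k Q => code (Quotient.out c)) fun c c' h => ?_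
  have := hcode _ _ h
  exact Quotient.out_equiv_out.1 this

end Locality

/-! ### Locality of the search -/

section SearchLocality

open scoped Classical

variable {V V' : Type u} [Fintype V] [Fintype V'] {G : SimpleGraph V} {G' : SimpleGraph V'}
  {C : Type} {col : V → C} {col' : V' → C} {K : ℕ} {c : ℝ}

theorem BallEquiv.improving_piece {r : ℕ} {v : V} {v' : V'} (E : BallEquiv G G' r v v')
    (hc : 0 ≤ c) (hr : K + 1 ≤ r) (hcol : ∀ y, G.edist v y ≤ r → col' (E.f y) = col y) {S : Finset V}
    {S' : Finset V'} (hS : ∀ y, G.edist v y ≤ r → (E.f y ∈ S' ↔ y ∈ S)) {A : Finset C}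
    (h : Improving G c S (piece G col K A v)) : Improving G' c S' (piece G' col' K A v') := by
  have hle : ∀ {y}, G.edist v y ≤ K → G.edist v y ≤ r := fun hy =>
    hy.trans (by exact_mod_cast (by omega : K ≤ r))
  have hle' : ∀ {y}, G'.edist v' y ≤ K → G'.edist v' y ≤ r := fun hy =>
    hy.trans (by exact_mod_cast (by omega : K ≤ r))
  have hpf : ∀ y ∈ piece G col K A v, E.f y ∈ piece G' col' K A v' := fun y hy => by
    simp only [piece, Finset.mem_filter, mem_fball] at hy ⊢
    exact ⟨E.edist_f_root_le (by omega) hy.1, by rw [hcol y (hle hy.1)]; exact hy.2⟩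
  have hpg : ∀ y ∈ piece G' col' K A v', E.g y ∈ piece G col K A v := fun y hy => by
    simp only [piece, Finset.mem_filter, mem_fball] at hy ⊢
    refine ⟨E.symm.edist_f_root_le (by omega) hy.1, ?_⟩
    rw [← hcol _ (E.g_mem y (hle' hy.1)), E.f_g y (hle' hy.1)]
    exact hy.2
  have hp : ∀ y ∈ piece G col K A v, G.edist v y ≤ r := fun y hy =>
    hle (mem_fball.1 (piece_subset _ _ hy))
  have hp' : ∀ y ∈ piece G' col' K A v', G'.edist v' y ≤ r := fun y hy =>
    hle' (mem_fball.1 (piece_subset _ _ hy))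
  refine ⟨fun y hy z hz hyz => ?_, fun y hy hyS => ?_, ?_, ?_⟩
  · exact h.indep _ (hpg y hy) _ (hpg z hz) ((E.symm.adj y z (hp' y hy) (hp' z hz)).2 hyz)
  · refine h.notMem _ (hpg y hy) ((hS _ (hp _ (hpg y hy))).1 ?_)
    rwa [E.f_g y (hp' y hy)]
  · obtain ⟨y, hy⟩ := h.nonempty
    exact ⟨_, hpf y hy⟩
  · have h1 : (piece G col K A v).card ≤ (piece G' col' K A v').card :=
      Finset.card_le_card_of_injOn E.f hpf fun y hy z hz hyz => by
        rw [← E.g_f y (hp y hy), hyz, E.g_f z (hp z hz)]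
    have h2 : (S' ∩ nbr G' (piece G' col' K A v')).card ≤ (S ∩ nbr G (piece G col K A v)).card := by
      have hm : ∀ y ∈ S' ∩ nbr G' (piece G' col' K A v'), G'.edist v' y ≤ r := fun y hy => by
        obtain ⟨z, hz, hzy⟩ := mem_nbr.1 (Finset.mem_inter.1 hy).2
        exact edist_le_add (mem_fball.1 (piece_subset _ _ hz)) (edist_le_one_of_adj hzy) hr
      refine Finset.card_le_card_of_injOn E.g (fun y hy => ?_) fun y hy z hz hyz => ?_
      · have hy' := hm y hy
        obtain ⟨hyS, hyn⟩ := Finset.mem_inter.1 hy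
        obtain ⟨z, hz, hzy⟩ := mem_nbr.1 hyn
        refine Finset.mem_inter.2 ⟨(hS _ (E.g_mem y hy')).1 ?_, mem_nbr.2 ⟨_, hpg z hz, ?_⟩⟩
        · rwa [E.f_g y hy']
        · exact (E.symm.adj z y (hp' z hz) hy').2 hzy
      · rw [← E.f_g y (hm y hy), hyz, E.f_g z (hm z hz)]
    calc c * (S' ∩ nbr G' (piece G' col' K A v')).card
        ≤ c * (S ∩ nbr G (piece G col K A v)).card :=
          mul_le_mul_of_nonneg_left (Nat.cast_le.2 h2) hc
      _ ≤ (piece G col K A v).card := h.card_le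
      _ ≤ (piece G' col' K A v').card := Nat.cast_le.2 h1

/-- A piece containing `z` has its centre within `K + 1` of `x`, and whether the exchange is
profitable depends on the `(K+1)`-ball of the centre. Hence one step has range `2 * K + 2`. -/
theorem BallEquiv.mem_inserted_of_mem {r : ℕ} {x : V} {x' : V'} (E : BallEquiv G G' r x x')
    (hc : 0 ≤ c) (hr : 2 * K + 2 ≤ r) (hcol : ∀ y, G.edist x y ≤ r → col' (E.f y) = col y)
    {S : Finset V} {S' : Finset V'} (hS : ∀ y, G.edist x y ≤ r → (E.f y ∈ S' ↔ y ∈ S))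
    {p : C × Finset C} {z : V} (hxz : G.edist x z ≤ (1 : ℕ)) (hz : z ∈ inserted G col K c p S) :
    E.f z ∈ inserted G' col' K c p S' := by
  obtain ⟨v, ⟨hv, himp⟩, hz⟩ := mem_inserted.1 hz
  have hvz := mem_fball.1 (piece_subset _ _ hz)
  have hxv : G.edist x v ≤ (K + 1 : ℕ) :=
    edist_le_add hxz (by rwa [G.edist_comm]) (by omega)
  have hsub : ∀ {y}, G.edist v y ≤ (K + 1 : ℕ) → G.edist x y ≤ r := fun hy =>
    edist_le_add hxv hy (by omega)
  let E' : BallEquiv G G' (K + 1) v (E.f v) := E.restrict (by omega) hxv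
  refine mem_inserted.2 ⟨E.f v, ⟨?_, E'.improving_piece hc le_rfl (fun y hy => hcol y (hsub hy))
    (fun y hy => hS y (hsub hy)) himp⟩, ?_⟩
  · rw [hcol v (hsub (by simp)), hv]
  · simp only [piece, Finset.mem_filter, mem_fball] at hz ⊢
    refine ⟨E'.edist_f_root_le (Nat.le_succ K) hz.1, ?_⟩
    rw [hcol z (hxz.trans (by exact_mod_cast (by omega : 1 ≤ r)))]
    exact hz.2

theorem BallEquiv.mem_step_of_mem {r : ℕ} {x : V} {x' : V'} (E : BallEquiv G G' r x x')
    (hc : 0 ≤ c) (hr : 2 * K + 2 ≤ r) (hcol : ∀ y, G.edist x y ≤ r → col' (E.f y) = col y)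
    {S : Finset V} {S' : Finset V'} (hS : ∀ y, G.edist x y ≤ r → (E.f y ∈ S' ↔ y ∈ S))
    {p : C × Finset C} (hx : x ∈ step G col K c p S) : x' ∈ step G' col' K c p S' := by
  have hcol' : ∀ y, G'.edist x' y ≤ r → col (E.symm.f y) = col' y := fun y hy => by
    rw [symm_f, ← hcol _ (E.g_mem y hy), E.f_g y hy]
  have hS' : ∀ y, G'.edist x' y ≤ r → (E.symm.f y ∈ S ↔ y ∈ S') := fun y hy => by
    rw [symm_f, ← hS _ (E.g_mem y hy), E.f_g y hy]
  simp only [step, Finset.mem_union, Finset.mem_sdiff] at hx ⊢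
  rcases hx with ⟨hx, hn⟩ | hx
  · refine Or.inl ⟨?_, fun hn' => hn ?_⟩
    · rw [← hS x (by simp), E.f_root] at hx
      exact hx
    · obtain ⟨z, hz, hzx⟩ := mem_nbr.1 hn'
      have hxz := edist_le_one_of_adj hzx.symm
      have h1 := E.symm.mem_inserted_of_mem hc hr hcol' hS' hxz hz
      refine mem_nbr.2 ⟨_, h1, ?_⟩
      have h2 := (E.symm.adj z x' (hxz.trans (by exact_mod_cast (by omega : 1 ≤ r)))
        (by simp)).2 hzx
      rwa [E.symm.f_root] at h2
  · have h1 := E.mem_inserted_of_mem hc hr hcol hS (by simp) hx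
    rw [E.f_root] at h1
    exact Or.inr h1

/-- The result of the local search at a vertex is determined by a ball around it. -/
theorem BallEquiv.mem_search_of_mem {lam : V → ℕ → Fin 2} {lam' : V' → ℕ → Fin 2} (hc : 0 ≤ c)
    {s : ℕ}
    (hcol : ∀ x x' (E : BallEquiv G G' s x x'),
      (∀ y, G.edist x y ≤ s → ∀ k < s, lam' (E.f y) k = lam y k) → col' x' = col x)
    (e : ℕ → C × Finset C) (n : ℕ) {x : V} {x' : V'}
    (E : BallEquiv G G' (s + n * (2 * K + 2)) x x')
    (hlam : ∀ y, G.edist x y ≤ (s + n * (2 * K + 2) : ℕ) → ∀ k < s + n * (2 * K + 2),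
      lam' (E.f y) k = lam y k) :
    x' ∈ search G' col' K c e n ↔ x ∈ search G col K c e n := by
  induction n generalizing x x' with
  | zero => simp [search]
  | succ n ih =>
    have hr : 2 * K + 2 + (s + n * (2 * K + 2)) ≤ s + (n + 1) * (2 * K + 2) := by
      rw [add_one_mul]; omega
    have hrs : 2 * K + 2 + s ≤ s + (n + 1) * (2 * K + 2) := by
      rw [add_one_mul]; omega
    let E' : BallEquiv G G' (2 * K + 2) x (E.f x) :=
      E.restrict (a := 0) (by omega) (by simp)
    have hS : ∀ y, G.edist x y ≤ (2 * K + 2 : ℕ) →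
        (E'.f y ∈ search G' col' K c e n ↔ y ∈ search G col K c e n) := fun y hy =>
      ih (E.restrict hr hy) fun z hz k hk => hlam z (edist_le_add hy hz hr) k (by omega)
    have hcl : ∀ y, G.edist x y ≤ (2 * K + 2 : ℕ) → col' (E'.f y) = col y := fun y hy =>
      hcol _ _ (E.restrict hrs hy) fun z hz k hk => hlam z (edist_le_add hy hz hrs) k (by omega)
    rw [← E.f_root]
    constructor
    · refine E'.symm.mem_step_of_mem hc le_rfl (fun y hy => ?_) (fun y hy => ?_)
      · rw [symm_f, ← hcl _ (E'.g_mem y hy), E'.f_g y hy]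
      · rw [symm_f, ← hS _ (E'.g_mem y hy), E'.f_g y hy]
    · exact E'.mem_step_of_mem hc le_rfl hcl hS

end SearchLocality

end LocalMIS

namespace LocalMIS

/-! ### Local certificates of almost-maximality -/

section Verifier

open scoped Classical

variable {V V' : Type u} [Fintype V] [Fintype V'] {G : SimpleGraph V} {G' : SimpleGraph V'}

/-- The total weight of the vertices at distance at most `R` from `y`. -/
noncomputable def localMass (G : SimpleGraph V) (q : ℝ) (R : ℕ) (y : V) : ℝ :=
  ∑ z ∈ fball G y R, expWeight q (G.edist y z)

/-- The weight of `y` as seen from `x`, normalised by the local mass. -/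
noncomputable def localKernel (G : SimpleGraph V) (q : ℝ) (R : ℕ) (x y : V) : ℝ :=
  expWeight q (G.edist x y) / localMass G q R y

/-- `S` is independent at `x` and its local weight around `x` is almost maximal among independent
sets. -/
def IsLocallyGood (G : SimpleGraph V) (q δ : ℝ) (R : ℕ) (S : Finset V) (x : V) : Prop :=
  (x ∈ S → ∀ y, G.Adj x y → y ∉ S) ∧ ∀ T, Indep G T →
    ∑ y ∈ T ∩ fball G x R, localKernel G q R x y
      ≤ (1 + δ) * ∑ y ∈ S ∩ fball G x R, localKernel G q R x y + δ

theorem one_le_localMass {q : ℝ} (hq : 0 ≤ q) (R : ℕ) (y : V) : 1 ≤ localMass G q R y := by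
  have := Finset.single_le_sum (f := fun z => expWeight q (G.edist y z)) (s := fball G y R)
    (fun z _ => expWeight_nonneg hq _) (mem_fball.2 (by simp : G.edist y y ≤ R))
  simpa [expWeight, localMass] using this

/-- Double counting: for fixed `y` the truncated weights over `x` sum to `1`, so the local sums add
up to a cardinality. -/
theorem sum_localKernel {q : ℝ} (hq : 0 ≤ q) (R : ℕ) (T : Finset V) :
    ∑ x, ∑ y ∈ T ∩ fball G x R, localKernel G q R x y = T.card := by
  calc ∑ x, ∑ y ∈ T ∩ fball G x R, localKernel G q R x y
      = ∑ y ∈ T, ∑ x ∈ fball G y R, localKernel G q R x y :=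
        Finset.sum_comm' fun x y => by
          simp only [Finset.mem_univ, Finset.mem_inter, mem_fball, true_and, G.edist_comm (u := x)]
          exact and_comm
    _ = ∑ y ∈ T, 1 := Finset.sum_congr rfl fun y _ => by
        unfold localKernel
        rw [← Finset.sum_div,
          div_eq_one_iff_eq (zero_lt_one.trans_le (one_le_localMass hq R y)).ne']
        exact Finset.sum_congr rfl fun x _ => by rw [G.edist_comm]
    _ = T.card := by simp

theorem indep_and_card_le_of_isLocallyGood {q δ : ℝ} (hq : 0 ≤ q) {R : ℕ} {S : Finset V}
    (h : ∀ x, IsLocallyGood G q δ R S x) :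
    Indep G S ∧ ∀ T, Indep G T → (T.card : ℝ) ≤ (1 + δ) * S.card + δ * Fintype.card V := by
  refine ⟨fun y hy z hz hyz => (h y).1 hy z hyz hz, fun T hT => ?_⟩
  have := Finset.sum_le_sum fun x (_ : x ∈ Finset.univ) => (h x).2 T hT
  rw [sum_localKernel hq, Finset.sum_add_distrib, ← Finset.mul_sum, sum_localKernel hq] at this
  simpa [mul_comm δ] using this

theorem BallEquiv.localMass_eq {q : ℝ} {R r : ℕ} {x : V} {x' : V'} (E : BallEquiv G G' r x x')
    (hr : 2 * R ≤ r) {y : V} (hy : G.edist x y ≤ R) :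
    localMass G' q R (E.f y) = localMass G q R y := by
  let E' : BallEquiv G G' R y (E.f y) := E.restrict (by omega) hy
  symm
  refine Finset.sum_nbij' E'.f E'.g (fun z hz => ?_) (fun z hz => ?_) (fun z hz => ?_)
    (fun z hz => ?_) fun z hz => ?_
  all_goals rw [mem_fball] at hz
  · exact mem_fball.2 (E'.f_mem z hz)
  · exact mem_fball.2 (E'.g_mem z hz)
  · exact E'.g_f z hz
  · exact E'.f_g z hz
  · rw [← E.edist_f_eq (by omega) hy hz]; rfl

theorem BallEquiv.localKernel_eq {q : ℝ} {R r : ℕ} {x : V} {x' : V'} (E : BallEquiv G G' r x x')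
    (hr : 2 * R ≤ r) {y : V} (hy : G.edist x y ≤ R) :
    localKernel G' q R x' (E.f y) = localKernel G q R x y := by
  have h := E.edist_f_eq (a := 0) (by omega) (by simp) hy
  rw [E.f_root] at h
  rw [localKernel, E.localMass_eq hr hy, h, localKernel]

theorem BallEquiv.sum_localKernel_eq {q : ℝ} {R r : ℕ} {x : V} {x' : V'}
    (E : BallEquiv G G' r x x') (hr : 2 * R ≤ r) {S : Finset V} {S' : Finset V'}
    (hS : ∀ y, G.edist x y ≤ R → (E.f y ∈ S' ↔ y ∈ S)) :
    ∑ y ∈ S' ∩ fball G' x' R, localKernel G' q R x' y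
      = ∑ y ∈ S ∩ fball G x R, localKernel G q R x y := by
  symm
  have hsub : ∀ {y}, G.edist x y ≤ R → G.edist x y ≤ r := fun hy =>
    hy.trans (by exact_mod_cast (by omega : R ≤ r))
  have hsub' : ∀ {y}, G'.edist x' y ≤ R → G'.edist x' y ≤ r := fun hy =>
    hy.trans (by exact_mod_cast (by omega : R ≤ r))
  refine Finset.sum_nbij' E.f E.g (fun y hy => ?_) (fun y hy => ?_) (fun y hy => ?_)
    (fun y hy => ?_) fun y hy => ?_
  all_goals
    simp only [Finset.mem_inter, mem_fball] at hy
    obtain ⟨hy1, hy2⟩ := hy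
  · exact Finset.mem_inter.2 ⟨(hS y hy2).2 hy1, mem_fball.2 (E.edist_f_root_le (by omega) hy2)⟩
  · have h := E.symm.edist_f_root_le (by omega : R ≤ r) hy2
    refine Finset.mem_inter.2 ⟨(hS _ h).1 ?_, mem_fball.2 h⟩
    rwa [symm_f, E.f_g y (hsub' hy2)]
  · exact E.g_f y (hsub hy2)
  · exact E.f_g y (hsub' hy2)
  · exact (E.localKernel_eq hr hy2).symm

/-- Local masses at points of the `R`-ball need radius `2 * R`; the extra `1` covers the
independence test when `R = 0`. A competing set is transferred by restricting it to the `R`-ball. -/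
theorem BallEquiv.isLocallyGood {q δ : ℝ} {R r : ℕ} {x : V} {x' : V'}
    (E : BallEquiv G G' r x x') (hr : 2 * R + 1 ≤ r) {S : Finset V} {S' : Finset V'}
    (hS : ∀ y, G.edist x y ≤ r → (E.f y ∈ S' ↔ y ∈ S)) (h : IsLocallyGood G q δ R S x) :
    IsLocallyGood G' q δ R S' x' := by
  have hsub : ∀ {y}, G.edist x y ≤ R → G.edist x y ≤ r := fun hy =>
    hy.trans (by exact_mod_cast (by omega : R ≤ r))
  refine ⟨fun hx y hxy hy => ?_, fun T' hT' => ?_⟩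
  · have h1 : G'.edist x' y ≤ r :=
      (edist_le_one_of_adj hxy).trans (by exact_mod_cast (by omega : 1 ≤ r))
    have h2 := (E.symm.adj x' y (by simp) h1).2 hxy
    rw [E.symm.f_root] at h2
    refine h.1 ((hS x (by simp)).1 ?_) _ h2 ((hS _ (E.g_mem y h1)).1 ?_)
    · rwa [E.f_root]
    · rwa [E.f_g y h1]
  · let T : Finset V := (fball G x R).filter fun y => E.f y ∈ T'
    have hT : Indep G T := fun y hy z hz hyz => by
      simp only [T, Finset.mem_filter, mem_fball] at hy hz
      exact hT' _ hy.2 _ hz.2 ((E.adj y z (hsub hy.1) (hsub hz.1)).2 hyz)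
    have h1 : ∑ y ∈ T' ∩ fball G' x' R, localKernel G' q R x' y
        = ∑ y ∈ T ∩ fball G x R, localKernel G q R x y :=
      E.sum_localKernel_eq (by omega) fun y hy => by
        simp [T, mem_fball, hy]
    rw [h1, E.sum_localKernel_eq (by omega) fun y hy => hS y (hsub hy)]
    exact h.2 T hT

/-- Passage from full to truncated weights: as the local mass is at least `1`, a tail of at most
`δ'` changes the mass by a factor at most `1 + δ'`, and cutting `S` down to the ball costs at most
`δ'`. -/
theorem isLocallyGood_of_forall {q : ℝ} (hq : 0 ≤ q) {R : ℕ} {S : Finset V} (hS : Indep G S)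
    {x : V} {a δ δ' : ℝ} (ha : 1 ≤ a) (hδ' : 0 ≤ δ')
    (htail : ∀ y, ∑ z with ¬ G.edist y z ≤ R, expWeight q (G.edist y z) ≤ δ')
    (h : ∀ T, Indep G T →
      ∑ y ∈ T ∩ fball G x R, kernel G q x y ≤ a * ∑ y ∈ S, kernel G q x y)
    (h1 : (1 + δ') * a ≤ 1 + δ) (h2 : (1 + δ) * δ' ≤ δ) :
    IsLocallyGood G q δ R S x := by
  have hmass : ∀ y, localMass G q R y ≤ mass G q y := fun y =>
    Finset.sum_le_sum_of_subset_of_nonneg (Finset.subset_univ _) fun z _ _ =>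
      expWeight_nonneg hq _
  have hmass' : ∀ y, mass G q y ≤ (1 + δ') * localMass G q R y := fun y => by
    have h3 : mass G q y = localMass G q R y
        + ∑ z with ¬ G.edist y z ≤ R, expWeight q (G.edist y z) :=
      (Finset.sum_filter_add_sum_filter_not Finset.univ (fun z => G.edist y z ≤ R) _).symm
    nlinarith [htail y, one_le_localMass (G := G) hq R y]
  have hpos : ∀ y, 0 < localMass G q R y := fun y => zero_lt_one.trans_le (one_le_localMass hq R y)
  have hk1 : ∀ y, kernel G q x y ≤ localKernel G q R x y := fun y =>
    div_le_div_of_nonneg_left (expWeight_nonneg hq _) (hpos y) (hmass y)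
  have hk2 : ∀ y, localKernel G q R x y ≤ (1 + δ') * kernel G q x y := fun y => by
    unfold localKernel kernel
    rw [← mul_div_assoc, div_le_div_iff₀ (hpos y) ((hpos y).trans_le (hmass y))]
    calc _ ≤ expWeight q (G.edist x y) * ((1 + δ') * localMass G q R y) :=
          mul_le_mul_of_nonneg_left (hmass' y) (expWeight_nonneg hq _)
      _ = _ := by ring
  refine ⟨fun hx y hxy hy => hS x hx y hy hxy, fun T hT => ?_⟩
  have h3 : ∑ y ∈ S, kernel G q x y ≤ ∑ y ∈ S ∩ fball G x R, localKernel G q R x y + δ' := by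
    rw [← Finset.sum_inter_add_sum_sdiff S (fball G x R)]
    refine add_le_add (Finset.sum_le_sum fun y _ => hk1 y) ?_
    refine le_trans ?_ (htail x)
    refine (Finset.sum_le_sum fun y _ => kernel_le hq x y).trans ?_
    refine Finset.sum_le_sum_of_subset_of_nonneg (fun y hy => ?_) fun z _ _ =>
      expWeight_nonneg hq _
    rw [Finset.mem_sdiff, mem_fball] at hy
    simpa using hy.2
  have h4 : 0 ≤ ∑ y ∈ S, kernel G q x y := Finset.sum_nonneg fun y _ => kernel_nonneg hq x y
  have h5 : 0 ≤ 1 + δ := le_trans (by positivity) h1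
  calc ∑ y ∈ T ∩ fball G x R, localKernel G q R x y
      ≤ (1 + δ') * ∑ y ∈ T ∩ fball G x R, kernel G q x y := by
        rw [Finset.mul_sum]; exact Finset.sum_le_sum fun y _ => hk2 y
    _ ≤ (1 + δ') * (a * ∑ y ∈ S, kernel G q x y) :=
        mul_le_mul_of_nonneg_left (h T hT) (by positivity)
    _ = (1 + δ') * a * ∑ y ∈ S, kernel G q x y := by ring
    _ ≤ (1 + δ) * ∑ y ∈ S, kernel G q x y := mul_le_mul_of_nonneg_right h1 h4
    _ ≤ (1 + δ) * (∑ y ∈ S ∩ fball G x R, localKernel G q R x y + δ') :=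
        mul_le_mul_of_nonneg_left h3 h5
    _ ≤ _ := by rw [mul_add]; linarith

omit [Fintype V] in
theorem indep_iff_isIndepSet {S : Finset V} : Indep G S ↔ G.IsIndepSet (S : Set V) := by
  refine ⟨fun h y hy z hz _ => h y hy z hz, fun h y hy z hz hyz => h hy hz hyz.ne hyz⟩

/-- The `1`-balls around a maximum independent set cover the graph. -/
theorem card_le_mul_indepNum {d : ℕ} (hG : DegreeBound G d) :
    Fintype.card V ≤ G.indepNum * (d + 1) := by
  obtain ⟨T, hT⟩ := G.exists_isNIndepSet_indepNum
  have hcov : (Finset.univ : Finset V) ⊆ T.biUnion fun t => fball G t 1 := fun y _ => by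
    by_contra hy
    simp only [Finset.mem_biUnion, mem_fball, not_exists, not_and] at hy
    have hyT : y ∉ T := fun h => hy y h (by simp)
    have hind : G.IsIndepSet (insert y T : Finset V) := by
      rw [← indep_iff_isIndepSet]
      have hT' := indep_iff_isIndepSet.2 hT.isIndepSet
      have hadj : ∀ z ∈ T, ¬ G.Adj z y := fun z hz h => hy z hz (edist_le_one_of_adj h)
      intro a ha b hb hab
      rw [Finset.mem_insert] at ha hb
      rcases ha with rfl | ha <;> rcases hb with rfl | hb
      · exact G.irrefl hab
      · exact hadj b hb hab.symm
      · exact hadj a ha hab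
      · exact hT' a ha b hb hab
    have h1 := hind.card_le_indepNum
    rw [Finset.card_insert_of_notMem hyT, hT.card_eq] at h1
    omega
  rw [← hT.card_eq, ← Finset.card_univ]
  exact (Finset.card_le_card hcov).trans
    (Finset.card_biUnion_le_card_mul _ _ _ fun t _ => by simpa using card_fball_le hG t 1)

theorem isIndepSet_and_le_ncard_of_isLocallyGood {d : ℕ} (hG : DegreeBound G d) {q δ ε : ℝ}
    (hq : 0 ≤ q) (hδ : 0 ≤ δ) (hε : 0 ≤ ε) (hδε : (d + 2) * δ ≤ ε) {R : ℕ} {S : Finset V}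
    (h : ∀ x, IsLocallyGood G q δ R S x) :
    G.IsIndepSet (S : Set V) ∧ (1 - ε) * (G.indepNum : ℝ) ≤ ((S : Set V).ncard : ℝ) := by
  obtain ⟨h1, h2⟩ := indep_and_card_le_of_isLocallyGood hq h
  refine ⟨indep_iff_isIndepSet.1 h1, ?_⟩
  obtain ⟨T, hT⟩ := G.exists_isNIndepSet_indepNum
  have h3 := h2 T (indep_iff_isIndepSet.2 hT.isIndepSet)
  rw [hT.card_eq] at h3
  rw [Set.ncard_coe_finset]
  have h4 : (Fintype.card V : ℝ) ≤ G.indepNum * (d + 1) := by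
    exact_mod_cast card_le_mul_indepNum hG
  have h5 : (0 : ℝ) ≤ G.indepNum := Nat.cast_nonneg _
  set N : ℝ := (G.indepNum : ℝ)
  have h6 : N * (1 - δ * (d + 1)) ≤ (1 + δ) * S.card := by
    nlinarith [mul_le_mul_of_nonneg_left h4 hδ]
  have h7 : (1 + δ) * ((1 - ε) * N) ≤ (1 + δ) * S.card := by
    refine le_trans ?_ h6
    have h8 : (1 + δ) * (1 - ε) ≤ 1 - δ * (d + 1) := by nlinarith [mul_nonneg hδ hε]
    nlinarith [mul_le_mul_of_nonneg_right h8 h5]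
  exact le_of_mul_le_mul_left h7 (by positivity)

end Verifier

/-! ### Choice of parameters and instruction sequences -/

section Constants

theorem exists_pow_close_to_one (n : ℕ) {η : ℝ} (hη : 0 < η) :
    ∃ q : ℝ, 0 < q ∧ q < 1 ∧ 1 ≤ (1 + η) * q ^ n := by
  have h1 : Filter.Tendsto (fun q : ℝ => (1 + η) * q ^ n) (nhdsWithin 1 (Set.Iio 1))
      (nhds ((1 + η) * 1 ^ n)) :=
    ((continuous_const.mul (continuous_pow n)).tendsto 1).mono_left nhdsWithin_le_nhds
  have h2 := h1.eventually (lt_mem_nhds (by simpa using hη : (1 : ℝ) < (1 + η) * 1 ^ n))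
  have h3 : ∀ᶠ q : ℝ in nhdsWithin 1 (Set.Iio 1), 0 < q :=
    nhdsWithin_le_nhds (lt_mem_nhds one_pos)
  obtain ⟨q, hq1, hq2, hq3⟩ := (h2.and (h3.and self_mem_nhdsWithin)).exists
  exact ⟨q, hq2, hq3, hq1.le⟩

theorem exists_periodic_enumeration (α : Type) [Finite α] [Nonempty α] :
    ∃ (e : ℕ → α) (P : ℕ), ∀ p k, ∃ n, k * P ≤ n ∧ n < (k + 1) * P ∧ e n = p := by
  obtain ⟨P, ⟨f⟩⟩ := Finite.exists_equiv_fin α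
  have hP : 0 < P := Fin.pos (f (Classical.arbitrary α))
  refine ⟨fun n => f.symm ⟨n % P, Nat.mod_lt _ hP⟩, P, fun p k => ⟨k * P + f p, ?_, ?_, ?_⟩⟩
  · omega
  · rw [add_one_mul]; omega
  · have : (k * P + f p) % P = f p := by
      rw [Nat.mul_add_mod_self_right, Nat.mod_eq_of_lt (f p).2]
    simp [this]

end Constants

end LocalMIS

namespace LocalMIS

/-! ### Success of the search and the verifier -/

section Completeness

open scoped Classical

/-- There are a number of rounds and a scale such that, in all doubling graphs with sufficiently
separated colours, the local search ends in a locally good independent set. -/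
theorem exists_search_isLocallyGood (d D : ℕ) {δ : ℝ} (hδ : 0 < δ) :
    ∃ (q c : ℝ) (K R M : ℕ), 0 ≤ q ∧ 0 ≤ c ∧
      ∀ (C : Type) (e : ℕ → C × Finset C) (P : ℕ),
        (∀ p k, ∃ n, k * P ≤ n ∧ n < (k + 1) * P ∧ e n = p) →
        ∀ (V : Type u) [Fintype V] (G : SimpleGraph V), DegreeBound G d → IsDoubling G D →
          ∀ col : V → C, (∀ y z, y ≠ z → G.edist y z ≤ (2 * K + 1 : ℕ) → col y ≠ col z) →
            ∀ x, IsLocallyGood G q δ R (search G col K c e (M * P)) x := by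
  obtain ⟨η, hη, hη1, hηδ⟩ : ∃ η : ℝ, 0 < η ∧ η ≤ 1 ∧ (1 + η) ^ 5 ≤ 1 + δ := by
    -- The nonconstant binomial coefficients of `(1 + η) ^ 5` sum to `31`.
    refine ⟨min 1 (δ / 31), by positivity, min_le_left _ _, ?_⟩
    set η := min 1 (δ / 31)
    have h0 : 0 < η := by positivity
    have h1 : η ≤ 1 := min_le_left _ _
    have h2 : η ≤ δ / 31 := min_le_right _ _
    have h3 : η ^ 2 ≤ η := by nlinarith
    have h4 : η ^ 3 ≤ η := by nlinarith
    have h5 : η ^ 4 ≤ η := by nlinarith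
    have h6 : η ^ 5 ≤ η := by nlinarith
    have : (1 + η) ^ 5 = 1 + 5 * η + 10 * η ^ 2 + 10 * η ^ 3 + 5 * η ^ 4 + η ^ 5 := by ring
    linarith
  -- The order matters: `q₁` fixes `K`, and only then is `q` taken so close to `1` that its kernel
  -- hardly varies across a `K`-ball.
  obtain ⟨q₁, hq₁, hq₁1, hq₁η⟩ := exists_pow_close_to_one 2 hη
  obtain ⟨K, hK⟩ := exists_tail_bound.{u} d D hq₁ hq₁1 (half_pos hη)
  obtain ⟨q, hq, hq1, hqη⟩ := exists_pow_close_to_one (4 * K + 2) (half_pos hη)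
  obtain ⟨δ', hδ', hδη, hδδ⟩ : ∃ δ' : ℝ, 0 < δ' ∧ δ' ≤ η ∧ (1 + δ) * δ' ≤ δ := by
    refine ⟨min η (δ / (1 + δ)), by positivity, min_le_left _ _, ?_⟩
    calc (1 + δ) * min η (δ / (1 + δ)) ≤ (1 + δ) * (δ / (1 + δ)) :=
          mul_le_mul_of_nonneg_left (min_le_right _ _) (by positivity)
      _ = δ := by field_simp
  obtain ⟨R, hR⟩ := exists_tail_bound.{u} d D hq hq1 hδ'
  obtain ⟨B, hB, hBmass⟩ := exists_mass_bound.{u} d D hq hq1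
  set r : ℝ := q * q with hr
  have hr0 : 0 < r := by positivity
  have hr1 : r ≤ 1 := mul_le_one₀ hq1.le hq.le hq1.le
  obtain ⟨κ, hκ, hκc⟩ : ∃ κ : ℝ, 0 < κ ∧ 1 ≤ (r ^ K - κ) * ((1 + η) * r ^ (K + 1)) := by
    -- With this `κ`, `(r ^ K - κ) * (1 + η) = r ^ K * (1 + η / 2)`, so the required product is
    -- exactly `(1 + η / 2) * q ^ (4 * K + 2)`.
    refine ⟨r ^ K * ((η / 2) / (1 + η)), by positivity, ?_⟩
    calc 1 ≤ (1 + η / 2) * q ^ (4 * K + 2) := hqη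
      _ = _ := by
        rw [hr]
        have : (1 + η) ≠ 0 := by positivity
        field_simp
        ring
  have hrη : 1 ≤ (1 + η) * r := by
    calc 1 ≤ (1 + η / 2) * q ^ (4 * K + 2) := hqη
      _ ≤ (1 + η) * q ^ 2 :=
        mul_le_mul (by linarith) (pow_le_pow_of_le_one hq.le hq1.le (by omega)) (by positivity)
          (by positivity)
      _ = (1 + η) * r := by rw [hr, sq]
  set L := R + K + (2 * K + 2) with hL
  obtain ⟨M, hM⟩ := exists_nat_gt (B / (κ * (q ^ L / B)))
  refine ⟨q, 1 + η, K, R, M, hq.le, by positivity, fun C e P he V _ G hG hD col hcol x => ?_⟩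
  -- Three factors `1 + η` pay for `r`, `q₁ ^ 2` and `1 - η / 2`, and the fourth is the exchange
  -- factor. A fifth pays for the truncation error `δ'`.
  refine isLocallyGood_of_forall hq.le (indep_search hcol e _) (a := (1 + η) ^ 4) (δ' := δ')
    (one_le_pow₀ (by linarith)) hδ'.le (fun y => hR V G hG hD y R le_rfl) (fun T hT => ?_) ?_ hδδ
  · have hF0 : ∀ y, 0 ≤ kernel G q x y := kernel_nonneg hq.le x
    have hF : IsSlow G r (kernel G q x) := isSlow_kernel hq hq1.le x
    have hβ : ∀ v, G.edist x v ≤ L → q ^ L / B ≤ kernel G q x v := fun v hv =>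
      div_le_div₀ (expWeight_nonneg hq.le _) (pow_le_expWeight hq.le hq1.le hv)
        (zero_lt_one.trans_le (one_le_mass hq.le v)) (hBmass V G hG hD v)
    have hsum : ∑ y, kernel G q x y < M * (κ * (q ^ L / B)) :=
      (Finset.sum_le_sum fun y _ => kernel_le hq.le x y).trans_lt
        ((hBmass V G hG hD x).trans_lt ((div_lt_iff₀ (by positivity)).1 hM))
    have hη0 : 0 ≤ 1 + η := by positivity
    obtain ⟨k, hk, hidle⟩ := exists_idle_round hcol hr0 hr1 hF0 hF hη0 hκ.le hκc e
      (P := P) hβ hsum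
    have h1 := sum_inter_fball_le_of_tail (c := 1 + η) (by linarith) hT (x := x) (K := K) (R := R)
      (fun v hv I hI => not_improving_of_idle hcol e he hidle hv hI) hq₁ hq₁1.le
      (fun y => hK V G hG hD y K le_rfl) hr0 hr1 hF0 hF
    have h2 := sum_search_mono hcol hr0 hr1 hF0 hF hη0 hκ.le hκc e
      (Nat.mul_le_mul_right P hk.le)
    simp only at h2
    set X := ∑ y ∈ T ∩ fball G x R, kernel G q x y
    have hX : 0 ≤ X := Finset.sum_nonneg fun y _ => hF0 y
    have h3 : 1 ≤ (1 + η) * (1 - η / 2) := by nlinarith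
    have h4 : 1 ≤ (1 + η) * r * ((1 + η) * q₁ ^ 2) * ((1 + η) * (1 - η / 2)) :=
      one_le_mul_of_one_le_of_one_le (one_le_mul_of_one_le_of_one_le hrη hq₁η) h3
    calc X ≤ (1 + η) * r * ((1 + η) * q₁ ^ 2) * ((1 + η) * (1 - η / 2)) * X :=
          le_mul_of_one_le_left hX h4
      _ = (1 + η) ^ 3 * (r * (q₁ * q₁) * ((1 - η / 2) * X)) := by ring
      _ ≤ (1 + η) ^ 3 * ((1 + η) * ∑ y ∈ search G col K (1 + η) e (M * P), kernel G q x y) :=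
          mul_le_mul_of_nonneg_left (h1.trans (mul_le_mul_of_nonneg_left h2 hη0)) (by positivity)
      _ = _ := by ring
  · calc (1 + δ') * (1 + η) ^ 4 ≤ (1 + η) * (1 + η) ^ 4 :=
          mul_le_mul_of_nonneg_right (by linarith) (by positivity)
      _ = (1 + η) ^ 5 := by ring
      _ ≤ 1 + δ := hηδ

/-- The verifier that checks whether the set of zeros is locally good. -/
noncomputable def verifier (d : ℕ) (q δ : ℝ) (R : ℕ)
    (b : BallClass.{u} d (2 * R + 1) (Fin 2)) : Bool :=
  decide (∃ (V : Type u) (_ : Fintype V) (G : SimpleGraph V) (hG : DegreeBound G d) (φ : V → Fin 2)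
    (x : V), ballClass hG φ (2 * R + 1) x = b ∧
      IsLocallyGood G q δ R (Finset.univ.filter fun y => φ y = 0) x)

theorem accepts_verifier_iff {d : ℕ} {q δ : ℝ} {R : ℕ} {V : Type u} [Fintype V]
    {G : SimpleGraph V} (hG : DegreeBound G d) (φ : V → Fin 2) :
    Accepts (verifier d q δ R) hG φ ↔
      ∀ x, IsLocallyGood G q δ R (Finset.univ.filter fun y => φ y = 0) x := by
  refine forall_congr' fun x => ?_
  rw [verifier, decide_eq_true_iff]
  refine ⟨?_, fun h => ⟨V, _, G, hG, φ, x, rfl, h⟩⟩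
  rintro ⟨V', _, G', hG', φ', x', hx, h⟩
  obtain ⟨E, hE⟩ := exists_ballEquiv_of_ballClass_eq hx
  exact E.isLocallyGood le_rfl (fun y hy => by simp [hE y hy]) h

end Completeness

end LocalMIS

/-- The multiset of graphs is the family `G i`, `i : ι`. -/
theorem mainTheorem8 (d D : ℕ) {ι : Type v} (V : ι → Type u) [∀ i, Finite (V i)]
    (G : ∀ i, SimpleGraph (V i)) (hdeg : ∀ i, LocalMIS.DegreeBound (G i) d)
    (hdoubling : ∀ i, LocalMIS.IsDoubling (G i) D)
    (lam : ∀ i, V i → ℕ → Fin 2) (hlam : LocalMIS.IsProperLabeling hdeg lam)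
    (ε : ℝ) (hε : 0 < ε) :
    ∃ (m l : ℕ) (Θ : LocalMIS.CantorBallClass.{u} d m → Fin 2)
      (Ω : LocalMIS.BallClass.{u} d l (Fin 2) → Bool),
      1 ≤ m ∧ 1 ≤ l ∧
      LocalMIS.IsLocalVerifier D ε Ω ∧
      ∀ i,
        (G i).IsIndepSet (LocalMIS.oracleLabeling Θ (hdeg i) (lam i) ⁻¹' {0}) ∧
        (1 - ε) * ((G i).indepNum : ℝ) ≤
          ((LocalMIS.oracleLabeling Θ (hdeg i) (lam i) ⁻¹' {0}).ncard : ℝ) ∧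
        LocalMIS.Accepts Ω (hdeg i) (LocalMIS.oracleLabeling Θ (hdeg i) (lam i)) := by
  classical
  open LocalMIS in
  let _ : ∀ i, Fintype (V i) := fun i => Fintype.ofFinite _
  -- One `δ` is lost as the factor `1 + δ`, and `d + 1` more through `|V| ≤ (d + 1) I(G)`.
  have hδ : 0 < ε / (d + 2) := by positivity
  have hδε : (d + 2) * (ε / (d + 2)) ≤ ε := by rw [mul_div_cancel₀ _ (by positivity)]
  obtain ⟨q, c, K, R, M, hq, hc, hgood⟩ := exists_search_isLocallyGood.{u} d D hδ
  obtain ⟨s, hs, hsep⟩ := hlam (2 * K + 1) (by omega)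
  have := finite_ballClass.{u} d s (Fin s → Fin 2)
  obtain ⟨N, ⟨code⟩⟩ := Finite.exists_equiv_fin (CantorBallClass.{u} d s)
  obtain ⟨e, P, he⟩ := exists_periodic_enumeration (Fin (N + 1) × Finset (Fin (N + 1)))
  -- One coding of ball classes serves the whole family, so equal balls in different graphs get
  -- equal colours. The spare colour makes the colour set visibly nonempty.
  let col : ∀ i, V i → Fin (N + 1) := fun i x =>
    (code (ballClass (hdeg i) (truncate (lam i) s) s x)).castSucc
  have hcode : ∀ i j x y, col i x = col j y ↔ ballClass (hdeg i) (truncate (lam i) s) s x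
      = ballClass (hdeg j) (truncate (lam j) s) s y := fun i j x y => by simp [col]
  have hcol : ∀ i y z, y ≠ z → (G i).edist y z ≤ (2 * K + 1 : ℕ) → col i y ≠ col i z :=
    fun i y z hne h => by
      rw [Ne, hcode]
      exact hsep i y z ((G i).edist_pos_of_ne hne) h
  let S : ∀ i, Finset (V i) := fun i => search (G i) (col i) K c e (M * P)
  have hS : ∀ i x, IsLocallyGood (G i) q (ε / (d + 2)) R (S i) x := fun i x =>
    hgood _ e P he (V i) (G i) (hdeg i) (hdoubling i) (col i) (hcol i) x
  let m := s + M * P * (2 * K + 2)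
  -- The answer is read from any representative of the class in the family; locality of the search
  -- makes it independent of that choice.
  let Θ : CantorBallClass.{u} d m → Fin 2 := fun b =>
    if ∃ i x, ballClass (hdeg i) (truncate (lam i) m) m x = b ∧ x ∈ S i then 0 else 1
  have hΘ : ∀ i x, oracleLabeling Θ (hdeg i) (lam i) x = 0 ↔ x ∈ S i := fun i x => by
    have h1 : oracleLabeling Θ (hdeg i) (lam i) x = 0 ↔ ∃ j y,
        ballClass (hdeg j) (truncate (lam j) m) m y
          = ballClass (hdeg i) (truncate (lam i) m) m x ∧ y ∈ S j := by
      simp only [oracleLabeling, Θ]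
      split_ifs with h <;> simp [h]
    rw [h1]
    refine ⟨?_, fun h => ⟨i, x, rfl, h⟩⟩
    rintro ⟨j, y, hb, hy⟩
    obtain ⟨E, hE⟩ := exists_ballEquiv_of_ballClass_eq hb
    refine (E.mem_search_of_mem (lam := lam j) (lam' := lam i) hc (fun x x' E' hE' => ?_) e (M * P)
      fun z hz k hk => ?_).2 hy
    · rw [eq_comm, hcode]
      exact ballClass_eq_of_ballEquiv _ _ E' fun z hz => funext fun k => hE' z hz k k.2
    · exact congrFun (hE z hz) ⟨k, hk⟩
  have hset : ∀ i, oracleLabeling Θ (hdeg i) (lam i) ⁻¹' {0} = (S i : Set (V i)) := fun i =>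
    Set.ext fun x => hΘ i x
  refine ⟨m, 2 * R + 1, Θ, verifier d q (ε / (d + 2)) R, by omega, by omega, ?_, fun i => ?_⟩
  · intro W _ H hH _ φ hφ
    let _ : Fintype W := Fintype.ofFinite W
    rw [accepts_verifier_iff] at hφ
    have := isIndepSet_and_le_ncard_of_isLocallyGood hH hq hδ.le hε.le hδε hφ
    have hcoe : ((Finset.univ.filter fun y => φ y = 0 : Finset W) : Set W) = φ ⁻¹' {0} := by
      ext; simp
    rwa [hcoe] at this
  · rw [hset, ← and_assoc]
    refine ⟨isIndepSet_and_le_ncard_of_isLocallyGood (hdeg i) hq hδ.le hε.le hδε (hS i), ?_⟩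
    rw [accepts_verifier_iff]
    have hfil : (Finset.univ.filter fun y => oracleLabeling Θ (hdeg i) (lam i) y = 0) = S i := by
      ext y
      simp [hΘ]
    rw [hfil]
    exact hS i
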